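/- Let $n\ge 1$. Let $\mathrm{Pol}^-_n$ be the unital $\mathbb Z$-algebra generated by $x_1,\dots,x_n$ subject to $x_ix_j+x_jx_i=0$ for $i\ne j$. For $1\le i\le n-1$ let $s_i$ be the ring endomorphism of $\mathrm{Pol}^-_n$ with $s_i(x_i)=-x_{i+1}$, $s_i(x_{i+1})=-x_i$ and $s_i(x_j)=-x_j$ for $j\neq i,i+1$, and let $s_n$ be the ring endomorphism with $s_n(x_j)=-x_j$ for all $j$. The type B odd Demazure operators $\partial_1,\dots,\partial_n$ are the $\mathbb Z$-linear operators on $\mathrm{Pol}^-_n$ with $\partial_i(1)=0$, the Leibniz rule $\partial_i(fg)=\partial_i(f)g+s_i(f)\partial_i(g)$, and, for $i\le n-1$, $\partial_i(x_j)=1$ if $j\in\{i,i+1\}$ and $\partial_i(x_j)=0$ otherwise, while $\partial_n(x_n)=1$ and $\partial_n(x_j)=0$ for $j<n$. Let $\Lambda^B_n=\bigcap_{i=1}^n\ker\partial_i$, the ring of spin type B symmetric polynomials, a subring of $\mathrm{Pol}^-_n$. The spin type B nilHecke algebra $\mathrm{NH}^B_n$ is the unital $\mathbb Z$-algebra generated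 by $x_1,\dots,x_n,\partial_1,\dots,\partial_n$ subject to $x_ix_j+x_jx_i=0$ ($i\neq j$); $\partial_i^2=0$ ($1\le i\le n$); $\partial_i\partial_{i+1}\partial_i=\partial_{i+1}\partial_i\partial_{i+1}$ ($1\le i\le n-2$); $\partial_n\partial_{n-1}\partial_n\partial_{n-1}=-\partial_{n-1}\partial_n\partial_{n-1}\partial_n$ (if $n\ge 2$); $\partial_i\partial_j+\partial_j\partial_i=0$ ($|i-j|>1$); $x_i\partial_i+\partial_ix_{i+1}=1$ and $\partial_ix_i+x_{i+1}\partial_i=1$ ($1\le i\le n-1$); $\partial_nx_n+x_n\partial_n=1$; and $\partial_ix_j+x_j\partial_i=0$ whenever $j\notin\{i,i+1\}$ ($1\le i,j\le n$). Grade $\mathrm{NH}^B_n$ and $\mathrm{Pol}^-_n$ (and so $\Lambda^B_n$) by $|x_i|=2$, $|\partial_i|=-2$, and call an endomorphism of $\mathrm{Pol}^-_n$ homogeneous of degree $k$ if it raises degrees by $k$. Put $[m]=\frac{q^m-q^{-m}}{q-q^{-1}}$ and $[2n]!!=[2n][2n-2]\cdots[4][2]$. Regard $\mathrm{Pol}^-_n$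 as a right $\Lambda^B_n$-module. Then letting the $x_i$ act by left multiplication and the $\partial_i$ by the odd Demazure operators defines an isomorphism of $\mathbb Z$-algebras $$\mathrm{NH}^B_n\xrightarrow{\ \cong\ }\operatorname{End}_{\Lambda^B_n}(\mathrm{Pol}^-_n),$$ under which the elements of degree $k$ correspond exactly to the endomorphisms of degree $k$, for every $k\in\mathbb Z$. Moreover $\operatorname{End}_{\Lambda^B_n}(\mathrm{Pol}^-_n)$, and hence $\mathrm{NH}^B_n$, is isomorphic as a graded $\mathbb Z$-algebra to the matrix algebra of graded size $q^{n^2}[2n]!!$ over $\Lambda^B_n$: with $N=2^nn!=|B_n|$, where $B_n$ is the Weyl group of type B (the group of signed permutations of $\{\pm1,\dots,\pm n\}$), there are integers $d_1,\dots,d_N\ge 0$ with $$\sum_{i=1}^N q^{d_i}=q^{n^2}[2n]!!$$ and a $\mathbb Z$-algebra isomorphism $\operatorname{End}_{\Lambda^B_n}(\mathrm{Pol}^-_n)\cong\mathrm{Mat}_N(\Lambda^B_n)$ under which the endomorphisms of degree $k$ correspond exactly to the matrices $(m_{ij})$ whose entry $m_{ij}$ is homogeneous of degree $k+d_j-d_i$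 for all $i,j$ (zero being homogeneous of every degree). -/

import Mathlib

open scoped Nat

/-- The relations `x_i x_j + x_j x_i = 0` (`i ≠ j`) in the free ring on `x_1, …, x_n`. -/
inductive SkewPolRel (n : ℕ) : FreeAlgebra ℤ (Fin n) → FreeAlgebra ℤ (Fin n) → Prop
  | anti (i j : Fin n) (h : i ≠ j) :
      SkewPolRel n
        (FreeAlgebra.ι ℤ i * FreeAlgebra.ι ℤ j + FreeAlgebra.ι ℤ j * FreeAlgebra.ι ℤ i) 0

/-- The skew-polynomial algebra `Pol⁻_n` over `ℤ`.  The variable `x_{i+1}` of the usual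
numbering is indexed by `i : Fin n`. -/
def SkewPol (n : ℕ) : Type := RingQuot (SkewPolRel n)

namespace SkewPol

noncomputable instance (n : ℕ) : Ring (SkewPol n) := inferInstanceAs (Ring (RingQuot _))

variable {n : ℕ}

/-- The quotient map from the free ring. -/
noncomputable def mk (n : ℕ) : FreeAlgebra ℤ (Fin n) →+* SkewPol n :=
  RingQuot.mkRingHom (SkewPolRel n)

/-- The generators of `Pol⁻_n`. -/
noncomputable def x (i : Fin n) : SkewPol n := mk n (FreeAlgebra.ι ℤ i)

theorem x_anti (i j : Fin n) (h : i ≠ j) : x i * x j + x j * x i = 0 := by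
  have : mk n (FreeAlgebra.ι ℤ i * FreeAlgebra.ι ℤ j + FreeAlgebra.ι ℤ j * FreeAlgebra.ι ℤ i)
      = mk n 0 := RingQuot.mkRingHom_rel (SkewPolRel.anti i j h)
  rwa [map_add, map_mul, map_mul, map_zero] at this

/-- The universal property of `Pol⁻_n`. -/
noncomputable def lift {A : Type} [Ring A] (f : Fin n → A)
    (hf : ∀ i j, i ≠ j → f i * f j + f j * f i = 0) : SkewPol n →+* A :=
  RingQuot.lift ⟨(FreeAlgebra.lift ℤ f : FreeAlgebra ℤ (Fin n) →ₐ[ℤ] A).toRingHom, by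
    rintro _ _ ⟨i, j, h⟩
    simpa using hf i j h⟩

theorem lift_x {A : Type} [Ring A] (f : Fin n → A)
    (hf : ∀ i j, i ≠ j → f i * f j + f j * f i = 0) (i : Fin n) : lift f hf (x i) = f i := by
  unfold lift x mk
  refine (RingQuot.lift_mkRingHom_apply _ _ _).trans ?_
  simp

/-- The index following `i` if there is one, and `i` itself if `i` is the last index. -/
def next (i : Fin n) : Fin n := if h : i.val + 1 < n then ⟨i.val + 1, h⟩ else i

/-- The ring endomorphisms `s_1, …, s_{n-1}, s_n` of `Pol⁻_n`:
`s_i` maps `x_i ↦ -x_{i+1}`, `x_{i+1} ↦ -x_i` and `x_j ↦ -x_j` otherwise (`1 ≤ i ≤ n-1`), and `s_n`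
maps every `x_j` to `-x_j` (for the last index `i` one has `next i = i`, and the transposition below
is the identity). -/
noncomputable def s (i : Fin n) : SkewPol n →+* SkewPol n :=
  lift (fun j => -x (Equiv.swap i (next i) j)) fun j k h => by
    have := x_anti _ _ ((Equiv.swap i (next i)).injective.ne h)
    simpa only [neg_mul_neg] using this

theorem s_x (i j : Fin n) : s i (x j) = -x (Equiv.swap i (next i) j) := lift_x _ _ _

/-- The values of the odd Demazure operators on the variables: `∂_i(x_j)` is `1` if
`j ∈ {i, i+1}` and `0` otherwise (`1 ≤ i ≤ n-1`), and `∂_n(x_j)` is `1` if `j = n` and `0`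
otherwise. -/
def demazureVal (i j : Fin n) : ℤ := if j = i ∨ j = next i then 1 else 0

theorem demazure_wellDefined (i j k : Fin n) (h : j ≠ k) :
    (demazureVal i j : SkewPol n) * (x k + s i (x k))
      + (demazureVal i k : SkewPol n) * (x j + s i (x j)) = 0 := by
  have key : ∀ l : Fin n, l ≠ i → l ≠ next i → x l + s i (x l) = 0 := by
    intro l h1 h2
    rw [s_x, Equiv.swap_apply_of_ne_of_ne h1 h2, add_neg_cancel]
  unfold demazureVal
  by_cases hj : j = i ∨ j = next i <;> by_cases hk : k = i ∨ k = next i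
  · rw [if_pos hj, if_pos hk, s_x, s_x]
    rcases hj with rfl | rfl <;> rcases hk with rfl | rfl
    · exact absurd rfl h
    · simp
    · simp
    · exact absurd rfl h
  · push Not at hk
    rw [if_pos hj, key k hk.1 hk.2, if_neg (by tauto)]
    simp
  · push Not at hj
    rw [if_pos hk, key j hj.1 hj.2, if_neg (by tauto)]
    simp
  · rw [if_neg hj, if_neg hk]
    simp

/-- The ring homomorphism `f ↦ !![s_i f, ∂_i f; 0, f]`, through which the operator `∂_i` is
constructed: its multiplicativity is the Leibniz rule `∂_i(fg) = ∂_i(f) g + s_i(f) ∂_i(g)`. -/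
noncomputable def demazureMat (i : Fin n) : SkewPol n →+* Matrix (Fin 2) (Fin 2) (SkewPol n) :=
  lift (fun j => !![s i (x j), (demazureVal i j : SkewPol n); 0, x j]) fun j k h => by
    have h1 : s i (x j) * s i (x k) + s i (x k) * s i (x j) = 0 := by
      rw [← map_mul, ← map_mul, ← map_add, x_anti j k h, map_zero]
    have h2 := demazure_wellDefined i j k h
    have e1 : s i (x j) * (demazureVal i k : SkewPol n)
        = (demazureVal i k : SkewPol n) * s i (x j) := (Int.cast_commute _ _).eq.symm
    have e2 : s i (x k) * (demazureVal i j : SkewPol n)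
        = (demazureVal i j : SkewPol n) * s i (x k) := (Int.cast_commute _ _).eq.symm
    ext a b
    fin_cases a <;> fin_cases b
    · simpa [Matrix.mul_apply, Fin.sum_univ_two] using h1
    · simp only [Matrix.add_apply, Matrix.mul_apply, Fin.sum_univ_two]
      simp only [Fin.zero_eta, Fin.mk_one, Matrix.of_apply, Matrix.cons_val', Matrix.cons_val_zero,
        Matrix.cons_val_one, Matrix.cons_val_fin_one, Matrix.zero_apply]
      rw [e1, e2, ← h2, mul_add, mul_add]
      abel
    · simp
    · simpa [Matrix.mul_apply, Fin.sum_univ_two] using x_anti j k h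

theorem demazureMat_lower (i : Fin n) (f : SkewPol n) :
    demazureMat i f 0 0 = s i f ∧ demazureMat i f 1 0 = 0 ∧ demazureMat i f 1 1 = f := by
  obtain ⟨p, rfl⟩ : ∃ p, mk n p = f := RingQuot.mkRingHom_surjective (SkewPolRel n) f
  induction p using FreeAlgebra.induction with
  | grade0 r =>
    rw [eq_intCast, map_intCast, map_intCast, map_intCast, ← Matrix.diagonal_intCast]
    simp
  | grade1 j =>
    change demazureMat i (x j) 0 0 = s i (x j) ∧ demazureMat i (x j) 1 0 = 0 ∧
      demazureMat i (x j) 1 1 = x j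
    rw [demazureMat, lift_x]
    simp
  | mul a b ha hb =>
    simp only [map_mul, Matrix.mul_apply, Fin.sum_univ_two]
    rw [ha.1, ha.2.1, ha.2.2, hb.1, hb.2.1, hb.2.2]
    simp
  | add a b ha hb =>
    simp only [map_add, Matrix.add_apply]
    rw [ha.1, ha.2.1, ha.2.2, hb.1, hb.2.1, hb.2.2]
    simp

/-- The type B odd Demazure operators `∂_1, …, ∂_{n-1}, ∂_n`; they are characterised by
`demazure_one`, `demazure_x` and the Leibniz rule `demazure_mul`. -/
noncomputable def demazure (i : Fin n) : SkewPol n →ₗ[ℤ] SkewPol n where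
  toFun f := demazureMat i f 0 1
  map_add' f g := by rw [map_add, Matrix.add_apply]
  map_smul' r f := by rw [map_zsmul, Matrix.smul_apply]; rfl

theorem demazure_one (i : Fin n) : demazure i 1 = 0 := by
  change demazureMat i 1 0 1 = 0
  rw [map_one]
  simp

theorem demazure_x (i j : Fin n) :
    demazure i (x j) = if j = i ∨ j = next i then 1 else 0 := by
  change demazureMat i (x j) 0 1 = _
  rw [demazureMat, lift_x]
  by_cases h : j = i ∨ j = next i <;> simp [demazureVal, h]

theorem demazure_mul (i : Fin n) (f g : SkewPol n) :
    demazure i (f * g) = demazure i f * g + s i f * demazure i g := by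
  change demazureMat i (f * g) 0 1 = demazureMat i f 0 1 * g + s i f * demazureMat i g 0 1
  rw [map_mul, Matrix.mul_apply, Fin.sum_univ_two, (demazureMat_lower i f).1,
    (demazureMat_lower i g).2.2]
  exact add_comm _ _

/-- The ring `Λ^B_n` of spin type B symmetric polynomials: the intersection of the kernels of
`∂_1, …, ∂_n`. -/
noncomputable def symm (n : ℕ) : Subring (SkewPol n) where
  carrier := {f | ∀ i : Fin n, demazure i f = 0}
  mul_mem' {f g} hf hg i := by rw [demazure_mul, hf i, hg i, zero_mul, mul_zero, add_zero]
  one_mem' i := demazure_one i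
  add_mem' {f g} hf hg i := by rw [map_add, hf i, hg i, add_zero]
  zero_mem' i := map_zero _
  neg_mem' {f} hf i := by rw [map_neg, hf i, neg_zero]

/-- The endomorphism ring `End_{Λ^B_n}(Pol⁻_n)` of `Pol⁻_n` as a right `Λ^B_n`-module; a right
module is a module over the opposite ring. -/
abbrev EndSymm (n : ℕ) : Type := Module.End (symm n).op (SkewPol n)

/-- The homogeneous component of degree `k` of `Pol⁻_n`, where every `x_i` has degree `2`. -/
noncomputable def deg (n : ℕ) (k : ℤ) : AddSubgroup (SkewPol n) :=
  AddSubgroup.closure {f | ∃ w : List (Fin n), 2 * (w.length : ℤ) = k ∧ f = (w.map x).prod}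

/-- `T` is homogeneous of degree `k`: it raises degrees in `Pol⁻_n` by `k`. -/
def EndHomogeneous (k : ℤ) (T : EndSymm n) : Prop :=
  ∀ (m : ℤ) (f : SkewPol n), f ∈ deg n m → T f ∈ deg n (m + k)

end SkewPol

/-- Generators of the spin type B nilHecke algebra: `x_1, …, x_n` and `∂_1, …, ∂_n`. -/
inductive NilHeckeGen (n : ℕ) : Type
  | x (i : Fin n)
  | d (i : Fin n)

namespace NilHeckeGen

/-- The generator `x_{i+1}` in the free ring. -/
noncomputable abbrev X {n : ℕ} (i : Fin n) : FreeAlgebra ℤ (NilHeckeGen n) :=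
  FreeAlgebra.ι ℤ (NilHeckeGen.x i)

/-- The generator `∂_{i+1}` in the free ring. -/
noncomputable abbrev D {n : ℕ} (i : Fin n) : FreeAlgebra ℤ (NilHeckeGen n) :=
  FreeAlgebra.ι ℤ (NilHeckeGen.d i)

/-- Degrees of the generators: `|x_i| = 2` and `|∂_i| = -2`. -/
def weight {n : ℕ} : NilHeckeGen n → ℤ
  | x _ => 2
  | d _ => -2

end NilHeckeGen

open NilHeckeGen in
/-- The defining relations of the spin type B nilHecke algebra.  The last index, the one with
`i.val + 1 = n`, belongs to the special generator `∂_n`. -/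
inductive NilHeckeRel (n : ℕ) :
    FreeAlgebra ℤ (NilHeckeGen n) → FreeAlgebra ℤ (NilHeckeGen n) → Prop
  | x_anti (i j : Fin n) (h : i ≠ j) : NilHeckeRel n (X i * X j + X j * X i) 0
  | d_sq (i : Fin n) : NilHeckeRel n (D i * D i) 0
  | braid (i j : Fin n) (h : i.val + 1 = j.val) (hj : j.val + 1 < n) :
      NilHeckeRel n (D i * D j * D i) (D j * D i * D j)
  | braid_last (i j : Fin n) (h : i.val + 1 = j.val) (hj : j.val + 1 = n) :
      NilHeckeRel n (D j * D i * D j * D i) (-(D i * D j * D i * D j))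
  | d_anti (i j : Fin n) (h : i.val + 1 < j.val) : NilHeckeRel n (D i * D j + D j * D i) 0
  | x_d (i j : Fin n) (h : i.val + 1 = j.val) : NilHeckeRel n (X i * D i + D i * X j) 1
  | d_x (i j : Fin n) (h : i.val + 1 = j.val) : NilHeckeRel n (D i * X i + X j * D i) 1
  | d_x_last (i : Fin n) (h : i.val + 1 = n) : NilHeckeRel n (D i * X i + X i * D i) 1
  | d_x_anti (i j : Fin n) (h : j.val ≠ i.val) (h' : j.val ≠ i.val + 1) :
      NilHeckeRel n (D i * X j + X j * D i) 0

/-- The spin type B nilHecke algebra over `ℤ`. -/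
def SpinNilHeckeB (n : ℕ) : Type := RingQuot (NilHeckeRel n)

namespace SpinNilHeckeB

noncomputable instance (n : ℕ) : Ring (SpinNilHeckeB n) := inferInstanceAs (Ring (RingQuot _))

variable {n : ℕ}

/-- The images of the generators in the spin type B nilHecke algebra. -/
noncomputable def gen (g : NilHeckeGen n) : SpinNilHeckeB n :=
  RingQuot.mkRingHom (NilHeckeRel n) (FreeAlgebra.ι ℤ g)

/-- The homogeneous component of degree `k` for the grading `|x_i| = 2`, `|∂_i| = -2`. -/
noncomputable def deg (n : ℕ) (k : ℤ) : AddSubgroup (SpinNilHeckeB n) :=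
  AddSubgroup.closure
    {a | ∃ w : List (NilHeckeGen n), (w.map NilHeckeGen.weight).sum = k ∧ a = (w.map gen).prod}

end SpinNilHeckeB

/-- The Weyl group `B_n`, realised as the group of signed permutations of `{±1, …, ±n}`: the
permutations that commute with the sign change. -/
def weylB (n : ℕ) : Subgroup (Equiv.Perm (Fin n × ℤˣ)) :=
  Subgroup.centralizer {Equiv.prodCongr (Equiv.refl (Fin n)) (Equiv.neg ℤˣ)}

/-- The `q`-integer `[m] = (q^m - q^{-m}) / (q - q^{-1})` in `ℚ(q)`. -/
noncomputable def qInt (m : ℕ) : RatFunc ℚ :=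
  (RatFunc.X ^ m - RatFunc.X⁻¹ ^ m) / (RatFunc.X - RatFunc.X⁻¹)

/-- The `q`-double factorial `[2n]!! = [2n][2n-2]⋯[4][2]`. -/
noncomputable def qDoubleFactorial (n : ℕ) : RatFunc ℚ :=
  ∏ k ∈ Finset.Icc 1 n, qInt (2 * k)

/-!
Throughout, indices are zero-based, so that the special generator is `∂_{n-1}`.

The proof treats the nilHecke algebra `NH` and its polynomial representation at once, by decomposing
an arbitrary left `NH`-module `M`.  Let `invariants n M k` be the elements of `M` annihilated by
`∂_k, …, ∂_{n-1}`.  These groups form a tower from `invariants n M n = M` down to the invariants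
`invariants n M 0`, and each step is free of rank `2 (n - k)`: every element of
`invariants n M (k + 1)` is a unique combination of `1, x_k, …, x_k ^ (2 (n - k) - 1)` with
coefficients in `invariants n M k`, and the coefficients are computed by elements of `NH`
(`coord_smul_X_pow`, `coord_decomposition`).

The coefficients are read off with the initial segments `w_j` of the word
`∂_k ∂_{k+1} ⋯ ∂_{n-1} ∂_{n-2} ⋯ ∂_k`, which represent the minimal coset representatives of type
`B_{n-k-1}` in type `B_{n-k}`.  On `invariants n M (k + 1)`, the element `w_j f` is annihilated by
`∂_k, …, ∂_{n-1}` except by the next letter (`D_smul_cosetWord`).  Two consequences follow.  First,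
`w_a` maps `x_k ^ a c` to `± c` and `x_k ^ b c` with `b < a` to `0`, for invariant `c`
(`cosetWord_smul_X_pow`).  Secondly, if `w_{a+1} f = 0` then `w_a f` is already invariant; so
`f ∓ x_k ^ a w_a f` is killed by `w_a`, and one continues downwards until `w_0 = 1` kills the
remainder.

Iterating along the tower gives `2 ^ n n!` monomials `b_i` and elements `γ_i` of `NH` such that
`f = ∑ b_i γ_i f` with `γ_i f` invariant, and `γ_i b_j c = δ_ij c` for invariant `c`
(`DualSystem`, `exists_dualSystem`).

* With `M = Pol`, whose invariants are the symmetric polynomials, the `b_i` form a homogeneous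
  basis of `Pol` over them.  This gives the matrix ring (`matrixEquiv`), and an endomorphism `T` is
  the action of `∑ T(b_i) γ_i`, whence surjectivity of `NH → End`.
* With `M = NH` and `f = 1` one gets `1 = ∑ b_i γ_i` with `∂_j γ_i = 0` for all `j`, so that
  `a = ∑ a b_i γ_i = ∑ a(b_i) γ_i` for every `a` in `NH` (`preimage_action`), whence injectivity.
  The same formula shows that `a` is homogeneous if its action is.
-/

namespace SpinNilHeckeB

variable {n : ℕ}

/-! ### The defining relations, with generators indexed by natural numbers -/

/-- The generator `x_{i+1}`, and `0` if `i` is out of range. -/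
noncomputable def X (n i : ℕ) : SpinNilHeckeB n :=
  if h : i < n then gen (NilHeckeGen.x ⟨i, h⟩) else 0

/-- The generator `∂_{i+1}`, and `0` if `i` is out of range. -/
noncomputable def D (n i : ℕ) : SpinNilHeckeB n :=
  if h : i < n then gen (NilHeckeGen.d ⟨i, h⟩) else 0

theorem X_val (i : Fin n) : X n i = gen (NilHeckeGen.x i) := dif_pos i.isLt

theorem D_val (i : Fin n) : D n i = gen (NilHeckeGen.d i) := dif_pos i.isLt

theorem D_of_le {i : ℕ} (h : n ≤ i) : D n i = 0 := dif_neg (by omega)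

theorem X_of_le {i : ℕ} (h : n ≤ i) : X n i = 0 := dif_neg (by omega)

/-- The quotient map from the free ring. -/
noncomputable def mk (n : ℕ) : FreeAlgebra ℤ (NilHeckeGen n) →+* SpinNilHeckeB n :=
  RingQuot.mkRingHom (NilHeckeRel n)

theorem mk_X (i : Fin n) : mk n (NilHeckeGen.X i) = gen (.x i) := rfl

theorem mk_D (i : Fin n) : mk n (NilHeckeGen.D i) = gen (.d i) := rfl

theorem mk_eq {a b : FreeAlgebra ℤ (NilHeckeGen n)} (h : NilHeckeRel n a b) : mk n a = mk n b :=
  RingQuot.mkRingHom_rel h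

theorem gen_x_anti (i j : Fin n) (h : i ≠ j) :
    gen (.x i) * gen (.x j) + gen (.x j) * gen (.x i) = 0 := by
  simpa only [mk_X, mk_D, map_add, map_mul, map_zero] using mk_eq (.x_anti i j h)

theorem D_mul_D_self (i : ℕ) : D n i * D n i = 0 := by
  by_cases h : i < n
  · simpa only [mk_X, mk_D, map_mul, map_zero, D, dif_pos h] using mk_eq (.d_sq (⟨i, h⟩ : Fin n))
  · rw [D_of_le (by omega), zero_mul]

theorem D_anti {i j : ℕ} (h : i + 1 < j ∨ j + 1 < i) : D n i * D n j = -(D n j * D n i) := by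
  by_cases hi : i < n
  · by_cases hj : j < n
    · have key : ∀ a b : Fin n, a.val + 1 < b.val →
          gen (.d a) * gen (.d b) + gen (.d b) * gen (.d a) = 0 := fun a b hab => by
        simpa only [mk_X, mk_D, map_add, map_mul, map_zero] using mk_eq (.d_anti a b hab)
      simp only [D, dif_pos hi, dif_pos hj]
      rcases h with h | h
      · exact eq_neg_of_add_eq_zero_left (key ⟨i, hi⟩ ⟨j, hj⟩ h)
      · exact eq_neg_of_add_eq_zero_right (key ⟨j, hj⟩ ⟨i, hi⟩ h)
    · simp [D_of_le (not_lt.mp hj)]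
  · simp [D_of_le (not_lt.mp hi)]

theorem D_braid {i : ℕ} (h : i + 2 < n) :
    D n i * D n (i + 1) * D n i = D n (i + 1) * D n i * D n (i + 1) := by
  have := mk_eq (.braid (⟨i, by omega⟩ : Fin n) ⟨i + 1, by omega⟩ rfl h)
  simpa only [mk_X, mk_D, map_mul, D, dif_pos (show i < n by omega),
    dif_pos (show i + 1 < n by omega)] using this

theorem D_braid_last {i : ℕ} (h : i + 2 = n) :
    D n (i + 1) * D n i * D n (i + 1) * D n i = -(D n i * D n (i + 1) * D n i * D n (i + 1)) := by
  have := mk_eq (.braid_last (⟨i, by omega⟩ : Fin n) ⟨i + 1, by omega⟩ rfl h)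
  simpa only [mk_X, mk_D, map_mul, map_neg, D, dif_pos (show i < n by omega),
    dif_pos (show i + 1 < n by omega)] using this

theorem D_mul_X_self {i : ℕ} (h : i + 1 < n) : D n i * X n i = 1 - X n (i + 1) * D n i := by
  have := mk_eq (.d_x (⟨i, by omega⟩ : Fin n) ⟨i + 1, h⟩ rfl)
  rw [eq_sub_iff_add_eq]
  simpa only [mk_X, mk_D, map_add, map_mul, map_one, D, X, dif_pos (show i < n by omega),
    dif_pos h] using this

theorem D_mul_X_succ {i : ℕ} (h : i + 1 < n) : D n i * X n (i + 1) = 1 - X n i * D n i := by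
  have := mk_eq (.x_d (⟨i, by omega⟩ : Fin n) ⟨i + 1, h⟩ rfl)
  rw [eq_sub_iff_add_eq, add_comm]
  simpa only [mk_X, mk_D, map_add, map_mul, map_one, D, X, dif_pos (show i < n by omega),
    dif_pos h] using this

theorem D_mul_X_last {i : ℕ} (h : i + 1 = n) : D n i * X n i = 1 - X n i * D n i := by
  have := mk_eq (.d_x_last (⟨i, by omega⟩ : Fin n) h)
  rw [eq_sub_iff_add_eq]
  simpa only [mk_X, mk_D, map_add, map_mul, map_one, D, X, dif_pos (show i < n by omega)] using this

theorem D_mul_X_of_ne {i j : ℕ} (h : j ≠ i) (h' : j ≠ i + 1) :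
    D n i * X n j = -(X n j * D n i) := by
  by_cases hi : i < n
  · by_cases hj : j < n
    · have := mk_eq (.d_x_anti (⟨i, hi⟩ : Fin n) ⟨j, hj⟩ h h')
      rw [eq_neg_iff_add_eq_zero]
      simpa only [mk_X, mk_D, map_add, map_mul, map_zero, D, X, dif_pos hi, dif_pos hj] using this
    · simp [X_of_le (not_lt.mp hj)]
  · simp [D_of_le (not_lt.mp hi)]

/-! ### Partial invariants in a module and the coset words -/

variable {M : Type*} [AddCommGroup M] [Module (SpinNilHeckeB n) M]

variable (n M) in
/-- The elements of a module over the nilHecke algebra that are annihilated by all Demazure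
generators of (zero-based) index at least `k`. -/
def invariants (k : ℕ) : AddSubgroup M where
  carrier := {f | ∀ i, k ≤ i → D n i • f = 0}
  add_mem' hf hg i hi := by rw [smul_add, hf i hi, hg i hi, add_zero]
  zero_mem' i _ := smul_zero _
  neg_mem' hf i hi := by rw [smul_neg, hf i hi, neg_zero]

theorem invariants_mono {k l : ℕ} (h : k ≤ l) : invariants n M k ≤ invariants n M l :=
  fun _ hf i hi => hf i (h.trans hi)

theorem D_smul_D_self (i : ℕ) (f : M) : D n i • D n i • f = 0 := by
  rw [← mul_smul, D_mul_D_self, zero_smul]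

theorem D_smul_comm_zero {i j : ℕ} (h : i + 1 < j ∨ j + 1 < i) {f : M} (hf : D n i • f = 0) :
    D n i • D n j • f = 0 := by
  rw [← mul_smul, D_anti h, neg_smul, mul_smul, hf, smul_zero, neg_zero]

theorem X_smul_mem_invariants {k : ℕ} {f : M} (hf : f ∈ invariants n M (k + 1)) :
    X n k • f ∈ invariants n M (k + 1) := fun i hi => by
  rw [← mul_smul, D_mul_X_of_ne (by omega) (by omega), neg_smul, mul_smul, hf i hi, smul_zero,
    neg_zero]

theorem X_pow_smul_mem_invariants {k : ℕ} {f : M} (hf : f ∈ invariants n M (k + 1)) (a : ℕ) :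
    X n k ^ a • f ∈ invariants n M (k + 1) := by
  induction a with
  | zero => simpa using hf
  | succ a ih => rw [pow_succ', mul_smul]; exact X_smul_mem_invariants ih

/-- The letters `k, k+1, …, n-1, n-2, …, k` of the longest minimal coset representative for the
parabolic subgroup of type `B_{n-k-1}` in `B_{n-k}`.  After them comes the out-of-range value `n`,
for which `D n n = 0`. -/
def letter (n k j : ℕ) : ℕ :=
  if j < n - k then k + j else if j + 1 < 2 * (n - k) then 2 * n - 2 - k - j else n

/-- The product of the Demazure generators along the first `j` letters of the word `letter n k`,
later letters standing further left. -/
noncomputable def cosetWord (n k : ℕ) : ℕ → SpinNilHeckeB n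
  | 0 => 1
  | j + 1 => D n (letter n k j) * cosetWord n k j

@[simp] theorem cosetWord_zero_smul (k : ℕ) (f : M) : cosetWord n k 0 • f = f := one_smul _ _

theorem cosetWord_succ_smul (k j : ℕ) (f : M) :
    cosetWord n k (j + 1) • f = D n (letter n k j) • cosetWord n k j • f := mul_smul _ _ _

theorem letter_up {k j : ℕ} (h : k + j < n) : letter n k j = k + j := if_pos (by omega)

theorem letter_down {k r : ℕ} (h : k + r + 1 < n) : letter n k (n - k + r) = n - 2 - r := by
  unfold letter
  rw [if_neg (by omega), if_pos (by omega)]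
  omega

theorem cosetWord_up {k j : ℕ} (h : k + j < n) (f : M) :
    cosetWord n k (j + 1) • f = D n (k + j) • cosetWord n k j • f := by
  rw [cosetWord_succ_smul, letter_up h]

theorem cosetWord_down {k r : ℕ} (h : k + r + 1 < n) (f : M) :
    cosetWord n k (n - k + (r + 1)) • f = D n (n - 2 - r) • cosetWord n k (n - k + r) • f := by
  rw [← add_assoc, cosetWord_succ_smul, letter_down h]

theorem D_smul_cosetWord_up_of_gt {k : ℕ} {f : M} (hf : f ∈ invariants n M (k + 1)) :
    ∀ {i j : ℕ}, k + j ≤ n → k + j < i → D n i • cosetWord n k j • f = 0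
  | i, 0, _, hi => by rw [cosetWord_zero_smul]; exact hf i hi
  | i, j + 1, hj, hi => by
    rw [cosetWord_up (by omega)]
    exact D_smul_comm_zero (by omega) (D_smul_cosetWord_up_of_gt hf (by omega) (by omega))

theorem D_smul_cosetWord_up_of_lt {k : ℕ} {f : M} (hf : f ∈ invariants n M (k + 1)) :
    ∀ {i j : ℕ}, k + j ≤ n → k ≤ i → i + 1 < k + j → i + 2 < n →
      D n i • cosetWord n k j • f = 0
  | _, 0, _, _, _, _ => by omega
  | i, j + 1, hj, hk, hi, hn => by
    rw [cosetWord_up (by omega)]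
    by_cases h : i + 1 < k + j
    · exact D_smul_comm_zero (by omega) (D_smul_cosetWord_up_of_lt hf (by omega) hk h hn)
    · obtain ⟨j, rfl⟩ : ∃ l, j = l + 1 := ⟨j - 1, by omega⟩
      obtain rfl : i = k + j := by omega
      rw [cosetWord_up (by omega), ← add_assoc, ← mul_smul, ← mul_smul, D_braid hn, mul_smul,
        D_smul_cosetWord_up_of_gt hf (by omega) (by omega), smul_zero]

theorem D_smul_cosetWord_down_of_lt {k : ℕ} {f : M} (hf : f ∈ invariants n M (k + 1)) :
    ∀ {i r : ℕ}, k + r + 1 ≤ n → k ≤ i → i + r + 2 < n →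
      D n i • cosetWord n k (n - k + r) • f = 0
  | i, 0, hr, hk, hi => D_smul_cosetWord_up_of_lt hf (by omega) hk (by omega) hi
  | i, r + 1, hr, hk, hi => by
    rw [cosetWord_down (by omega)]
    exact D_smul_comm_zero (by omega) (D_smul_cosetWord_down_of_lt hf (by omega) hk (by omega))

theorem D_last_smul_cosetWord_down {k : ℕ} {f : M} (hf : f ∈ invariants n M (k + 1)) :
    ∀ {r : ℕ}, k + r + 2 ≤ n → D n (n - 1) • cosetWord n k (n - k + (r + 1)) • f = 0
  | 0, hr => by
    obtain ⟨p, rfl⟩ : ∃ p, n = k + p + 2 := ⟨n - k - 2, by omega⟩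
    rw [cosetWord_down (by omega), show k + p + 2 - k + 0 = p + 1 + 1 by omega,
      cosetWord_up (by omega), cosetWord_up (by omega),
      show k + p + 2 - 2 - 0 = k + p by omega, show k + p + 2 - 1 = k + p + 1 by omega,
      ← add_assoc, ← mul_smul, ← mul_smul, ← mul_smul, D_braid_last rfl, neg_smul, mul_smul,
      D_smul_cosetWord_up_of_gt hf (by omega) (by omega), smul_zero, neg_zero]
  | r + 1, hr => by
    rw [cosetWord_down (by omega)]
    exact D_smul_comm_zero (by omega) (D_last_smul_cosetWord_down hf (by omega))

theorem D_smul_cosetWord_down_of_gt {k : ℕ} {f : M} (hf : f ∈ invariants n M (k + 1)) :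
    ∀ {i r : ℕ}, k + r + 1 ≤ n → i + 2 ≤ n → n ≤ i + r →
      D n i • cosetWord n k (n - k + r) • f = 0
  | _, 0, _, _, _ => by omega
  | i, r + 1, hr, hk, hi => by
    rw [cosetWord_down (by omega)]
    by_cases h : n ≤ i + r
    · exact D_smul_comm_zero (by omega) (D_smul_cosetWord_down_of_gt hf (by omega) hk h)
    · obtain ⟨r, rfl⟩ : ∃ l, r = l + 1 := ⟨r - 1, by omega⟩
      obtain ⟨i, rfl⟩ : ∃ l, i = l + 1 := ⟨i - 1, by omega⟩
      rw [cosetWord_down (by omega), show n - 2 - (r + 1) = i by omega,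
        show n - 2 - r = i + 1 by omega, ← mul_smul, ← mul_smul, ← D_braid (by omega), mul_smul,
        D_smul_cosetWord_down_of_lt hf (by omega) (by omega) (by omega), smul_zero]

/-- A coset word turns elements annihilated by the generators of index `> k` into elements
annihilated by all generators of index `≥ k` but the next letter of the word: multiplying a minimal
coset representative by any other generator shortens it or leaves its coset unchanged. -/
theorem D_smul_cosetWord {k i j : ℕ} (hj : j < 2 * (n - k)) (hk : k ≤ i) (hi : i ≠ letter n k j)
    {f : M} (hf : f ∈ invariants n M (k + 1)) : D n i • cosetWord n k j • f = 0 := by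
  by_cases hin : n ≤ i
  · rw [D_of_le hin, zero_smul]
  by_cases h : k + j < n
  -- The next letter belongs to the ascending half of the word; the last letter is `k + j - 1`.
  · rw [letter_up h] at hi
    by_cases h1 : k + j < i
    · exact D_smul_cosetWord_up_of_gt hf h.le h1
    by_cases h2 : i + 1 < k + j
    · exact D_smul_cosetWord_up_of_lt hf h.le hk h2 (by omega)
    obtain ⟨j, rfl⟩ : ∃ l, j = l + 1 := ⟨j - 1, by omega⟩
    obtain rfl : i = k + j := by omega
    rw [cosetWord_up (by omega), D_smul_D_self]
  -- The whole ascending half and `r` letters of the descending one have been used; the last letter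
  -- is `n - 1 - r`.
  · obtain ⟨r, rfl⟩ : ∃ r, j = n - k + r := ⟨j - (n - k), by omega⟩
    have hr : k + r + 1 ≤ n := by omega
    have hi' : i + r + 2 ≠ n := fun h' => hi (by rw [letter_down (by omega)]; omega)
    by_cases h1 : i + r + 2 < n
    · exact D_smul_cosetWord_down_of_lt hf hr hk h1
    rcases r with _ | r
    · obtain ⟨m, hm⟩ : ∃ m, n - k = m + 1 := ⟨n - k - 1, by omega⟩
      rw [add_zero, hm, cosetWord_up (by omega), show i = k + m by omega, D_smul_D_self]
    by_cases h2 : i + 1 = n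
    · rw [show i = n - 1 by omega]
      exact D_last_smul_cosetWord_down hf (by omega)
    by_cases h3 : n ≤ i + (r + 1)
    · exact D_smul_cosetWord_down_of_gt hf hr (by omega) h3
    rw [cosetWord_down (by omega), show i = n - 2 - r by omega, D_smul_D_self]

end SpinNilHeckeB

namespace SpinNilHeckeB

variable {n : ℕ}

/-! ### Coset words acting on powers of a variable -/

variable {M : Type*} [AddCommGroup M] [Module (SpinNilHeckeB n) M]

/-- The index of the variable into which `x_k` turns when it is moved to the left past the first
`j` letters of the word `letter n k`. -/
def movedIndex (n k j : ℕ) : ℕ := if j < n - k then k + j else 2 * n - 1 - k - j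

theorem D_letter_smul_X_movedIndex {k j : ℕ} (hj : j + 1 < 2 * (n - k)) (f : M) :
    D n (letter n k j) • X n (movedIndex n k j) • f =
      f - X n (movedIndex n k (j + 1)) • D n (letter n k j) • f := by
  have key : D n (letter n k j) * X n (movedIndex n k j) =
      1 - X n (movedIndex n k (j + 1)) * D n (letter n k j) := by
    unfold letter movedIndex
    by_cases h : j + 1 < n - k
    · simp only [if_pos (show j < n - k by omega), if_pos h]
      exact D_mul_X_self (by omega)
    by_cases h' : j < n - k
    · simp only [if_pos h', if_neg h]
      rw [show 2 * n - 1 - k - (j + 1) = k + j by omega]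
      exact D_mul_X_last (by omega)
    · simp only [if_neg h', if_neg h, if_pos hj]
      rw [show 2 * n - 1 - k - j = 2 * n - 2 - k - j + 1 by omega,
        show 2 * n - 1 - k - (j + 1) = 2 * n - 2 - k - j by omega]
      exact D_mul_X_succ (by omega)
  rw [← mul_smul, key, sub_smul, one_smul, mul_smul]

theorem letter_succ_ne {k j : ℕ} (hj : j + 2 < 2 * (n - k)) :
    letter n k (j + 1) ≠ letter n k j := by
  unfold letter
  split_ifs <;> omega

theorem le_letter {k j : ℕ} (hk : k ≤ n) : k ≤ letter n k j := by
  unfold letter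
  split_ifs <;> omega

/-- The twisted commutation of a coset word with `x_k`.  Of all the terms in which one letter has
been dropped only the one without the last letter survives on partial invariants. -/
theorem cosetWord_succ_smul_X_smul {k : ℕ} (hk : k ≤ n) {f : M}
    (hf : f ∈ invariants n M (k + 1)) :
    ∀ {j : ℕ}, j + 1 < 2 * (n - k) → cosetWord n k (j + 1) • X n k • f =
      (-1 : ℤ) ^ j • cosetWord n k j • f -
        (-1 : ℤ) ^ j • X n (movedIndex n k (j + 1)) • cosetWord n k (j + 1) • f
  | 0, hj => by
    have h := D_letter_smul_X_movedIndex hj f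
    have h0 : movedIndex n k 0 = k := by unfold movedIndex; split_ifs <;> omega
    rw [h0] at h
    simpa [cosetWord_succ_smul] using h
  | j + 1, hj => by
    have ih := cosetWord_succ_smul_X_smul hk hf (j := j) (by omega)
    rw [cosetWord_succ_smul, ih, smul_sub, smul_comm (D n _) ((-1 : ℤ) ^ j),
      smul_comm (D n _) ((-1 : ℤ) ^ j), D_letter_smul_X_movedIndex (by omega),
      D_smul_cosetWord (by omega) (le_letter hk) (letter_succ_ne hj) hf,
      ← cosetWord_succ_smul, pow_succ, smul_zero, zero_sub, smul_sub, mul_neg_one, neg_smul,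
      neg_smul, sub_neg_eq_add, neg_sub, sub_eq_neg_add]

theorem cosetWord_smul_of_mem {k j : ℕ} (hk : k ≤ n) (hj : j ≠ 0) {c : M}
    (hc : c ∈ invariants n M k) : cosetWord n k j • c = 0 := by
  induction j with
  | zero => exact absurd rfl hj
  | succ j ih =>
    rw [cosetWord_succ_smul]
    by_cases h : j = 0
    · rw [h, cosetWord_zero_smul]
      exact hc _ (le_letter hk)
    · rw [ih h, smul_zero]

theorem cosetWord_smul_X_pow_of_lt {k a b : ℕ} (hk : k ≤ n) (ha : a < 2 * (n - k)) (hab : b < a)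
    {c : M} (hc : c ∈ invariants n M k) : cosetWord n k a • X n k ^ b • c = 0 := by
  induction b generalizing a with
  | zero =>
    rw [pow_zero, one_smul]
    exact cosetWord_smul_of_mem hk (by omega) hc
  | succ b ih =>
    obtain ⟨a, rfl⟩ : ∃ l, a = l + 1 := ⟨a - 1, by omega⟩
    rw [pow_succ', mul_smul, cosetWord_succ_smul_X_smul hk
      (X_pow_smul_mem_invariants (invariants_mono (Nat.le_succ k) hc) b) ha,
      ih (by omega) (by omega), ih ha (by omega)]
    simp

/-- The sign by which the `a`-th coset word maps the `a`-th power of its variable to `1`. -/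
def cosetSign (a : ℕ) : ℤ := (-1) ^ (a.choose 2)

theorem cosetSign_succ (a : ℕ) : cosetSign (a + 1) = (-1) ^ a * cosetSign a := by
  rw [cosetSign, cosetSign, Nat.choose_succ_succ', Nat.choose_one_right, pow_add]

theorem cosetSign_mul_self (a : ℕ) : cosetSign a * cosetSign a = 1 := by
  rw [cosetSign, ← mul_pow]
  simp

theorem cosetWord_smul_X_pow {k a : ℕ} (hk : k ≤ n) (ha : a < 2 * (n - k)) {c : M}
    (hc : c ∈ invariants n M k) : cosetWord n k a • X n k ^ a • c = cosetSign a • c := by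
  induction a with
  | zero => simp [cosetSign]
  | succ a ih =>
    rw [pow_succ', mul_smul, cosetWord_succ_smul_X_smul hk
      (X_pow_smul_mem_invariants (invariants_mono (Nat.le_succ k) hc) a) ha,
      cosetWord_smul_X_pow_of_lt hk ha (by omega) hc, ih (by omega), cosetSign_succ, smul_smul]
    simp

/-! ### Coordinates with respect to the powers of a variable -/

/-- The coset word normalised so that it maps the `a`-th power of its variable to `1`. -/
noncomputable def leadCoord (n k a : ℕ) : SpinNilHeckeB n := cosetSign a • cosetWord n k a

/-- Elements of the nilHecke algebra that compute, on combinations of `1, x_k, …, x_k ^ (a - 1)`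
with coefficients in `invariants n M k`, the coefficient of `x_k ^ b`.  The leading coefficient is
computed by a coset word; the others are found after subtracting the leading term. -/
noncomputable def coord (n k : ℕ) : ℕ → ℕ → SpinNilHeckeB n
  | 0, _ => 0
  | a + 1, b => if b = a then leadCoord n k a else coord n k a b * (1 - X n k ^ a * leadCoord n k a)

theorem leadCoord_smul (k a : ℕ) (f : M) :
    leadCoord n k a • f = cosetSign a • cosetWord n k a • f := smul_assoc _ _ _

theorem coord_succ_self (k a : ℕ) : coord n k (a + 1) a = leadCoord n k a := if_pos rfl

theorem coord_succ_smul_of_ne {k a b : ℕ} (h : b ≠ a) (f : M) :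
    coord n k (a + 1) b • f = coord n k a b • (f - X n k ^ a • leadCoord n k a • f) := by
  rw [coord, if_neg h, mul_smul, sub_smul, one_smul, mul_smul]

theorem leadCoord_smul_X_pow {k a b : ℕ} (hk : k ≤ n) (ha : a < 2 * (n - k)) (hb : b ≤ a) {c : M}
    (hc : c ∈ invariants n M k) : leadCoord n k a • X n k ^ b • c = if a = b then c else 0 := by
  rw [leadCoord_smul]
  split_ifs with h
  · rw [← h, cosetWord_smul_X_pow hk ha hc, smul_smul, cosetSign_mul_self, one_smul]
  · rw [cosetWord_smul_X_pow_of_lt hk ha (by omega) hc, smul_zero]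

/-- The powers of `x_k` are independent over the invariants: `coord` extracts the coefficients. -/
theorem coord_smul_X_pow {k : ℕ} (hk : k ≤ n) {c : M} (hc : c ∈ invariants n M k) :
    ∀ {a b b' : ℕ}, a ≤ 2 * (n - k) → b < a → b' < a →
      coord n k a b • X n k ^ b' • c = if b = b' then c else 0
  | 0, _, _, _, hb, _ => by omega
  | a + 1, b, b', ha, hb, hb' => by
    by_cases h : b = a
    · rw [h, coord_succ_self, leadCoord_smul_X_pow hk (by omega) (by omega) hc]
    rw [coord_succ_smul_of_ne h, leadCoord_smul_X_pow hk (by omega) (by omega) hc]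
    by_cases h' : a = b'
    · rw [if_pos h', if_neg (by omega), h', sub_self, smul_zero]
    · rw [if_neg h', smul_zero, sub_zero,
        coord_smul_X_pow hk hc (by omega) (by omega) (by omega)]

/-- If the next coset word annihilates `f`, the leading coefficient of `f` is invariant: the only
generator that might fail to annihilate it is the next letter. -/
theorem leadCoord_smul_mem {k a : ℕ} (ha : a < 2 * (n - k)) {f : M}
    (hf : f ∈ invariants n M (k + 1)) (h0 : cosetWord n k (a + 1) • f = 0) :
    leadCoord n k a • f ∈ invariants n M k := by
  rw [leadCoord_smul]
  refine AddSubgroup.zsmul_mem _ (fun i hi => ?_) _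
  by_cases h : i = letter n k a
  · rw [h, ← cosetWord_succ_smul, h0]
  · exact D_smul_cosetWord ha hi h hf

/-- Elements annihilated by the `a`-th coset word are combinations of `1, x_k, …, x_k ^ (a - 1)` with
invariant coefficients, which are computed by `coord n k a`. -/
theorem coord_decomposition {k : ℕ} (hk : k ≤ n) :
    ∀ {a : ℕ}, a ≤ 2 * (n - k) → ∀ {f : M}, f ∈ invariants n M (k + 1) →
      cosetWord n k a • f = 0 →
      (∀ b < a, coord n k a b • f ∈ invariants n M k) ∧
        ∑ b ∈ Finset.range a, X n k ^ b • coord n k a b • f = f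
  | 0, _, f, _, h0 => by
    rw [cosetWord_zero_smul] at h0
    simp [h0]
  | a + 1, ha, f, hf, h0 => by
    have hc := leadCoord_smul_mem (by omega) hf h0
    set c := leadCoord n k a • f with hcdef
    have hf' : f - X n k ^ a • c ∈ invariants n M (k + 1) :=
      sub_mem hf (X_pow_smul_mem_invariants (invariants_mono (Nat.le_succ k) hc) a)
    have h0' : cosetWord n k a • (f - X n k ^ a • c) = 0 := by
      rw [smul_sub, cosetWord_smul_X_pow hk (by omega) hc, hcdef, leadCoord_smul, smul_smul,
        cosetSign_mul_self, one_smul, sub_self]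
    obtain ⟨h1, h2⟩ := coord_decomposition hk (by omega) hf' h0'
    constructor
    · intro b hb
      by_cases h : b = a
      · rwa [h, coord_succ_self]
      · rw [coord_succ_smul_of_ne h]
        exact h1 b (by omega)
    · rw [Finset.sum_range_succ, coord_succ_self, Finset.sum_congr rfl fun b hb => by
        rw [coord_succ_smul_of_ne (Finset.mem_range.mp hb).ne], h2, sub_add_cancel]

/-- At full length the hypothesis of `coord_decomposition` is void: the letter after the last one is
the out-of-range value `n`. -/
theorem cosetWord_length_smul {k : ℕ} (hk : k < n) (f : M) :
    cosetWord n k (2 * (n - k)) • f = 0 := by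
  obtain ⟨j, hj⟩ : ∃ j, 2 * (n - k) = j + 1 := ⟨2 * (n - k) - 1, by omega⟩
  have : letter n k j = n := by
    unfold letter
    rw [if_neg (by omega), if_neg (by omega)]
  rw [hj, cosetWord_succ_smul, this, D_of_le le_rfl, zero_smul]

/-! ### Degrees in the nilHecke algebra -/

theorem deg_eq {k l : ℤ} (h : k = l) {a : SpinNilHeckeB n} (ha : a ∈ deg n k) : a ∈ deg n l :=
  h ▸ ha

theorem one_mem_deg : (1 : SpinNilHeckeB n) ∈ deg n 0 :=
  AddSubgroup.subset_closure ⟨[], rfl, rfl⟩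

theorem gen_mem_deg (g : NilHeckeGen n) : gen g ∈ deg n g.weight :=
  AddSubgroup.subset_closure ⟨[g], by simp, by simp⟩

theorem mul_mem_deg {k l : ℤ} {a b : SpinNilHeckeB n} (ha : a ∈ deg n k) (hb : b ∈ deg n l) :
    a * b ∈ deg n (k + l) := by
  induction ha using AddSubgroup.closure_induction with
  | mem a ha =>
    obtain ⟨v, rfl, rfl⟩ := ha
    induction hb using AddSubgroup.closure_induction with
    | mem b hb =>
      obtain ⟨w, rfl, rfl⟩ := hb
      exact AddSubgroup.subset_closure ⟨v ++ w, by simp, by simp⟩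
    | zero => rw [mul_zero]; exact zero_mem _
    | add b b' _ _ h h' => rw [mul_add]; exact add_mem h h'
    | neg b _ h => rw [mul_neg]; exact neg_mem h
  | zero => rw [zero_mul]; exact zero_mem _
  | add a a' _ _ h h' => rw [add_mul]; exact add_mem h h'
  | neg a _ h => rw [neg_mul]; exact neg_mem h

theorem X_mem_deg (i : ℕ) : X n i ∈ deg n 2 := by
  unfold X
  split_ifs with h
  · exact gen_mem_deg (NilHeckeGen.x ⟨i, h⟩)
  · exact zero_mem _

theorem D_mem_deg (i : ℕ) : D n i ∈ deg n (-2) := by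
  unfold D
  split_ifs with h
  · exact gen_mem_deg (NilHeckeGen.d ⟨i, h⟩)
  · exact zero_mem _

theorem X_pow_mem_deg (i a : ℕ) : X n i ^ a ∈ deg n (2 * a) := by
  induction a with
  | zero => simpa using one_mem_deg
  | succ a ih => rw [pow_succ]; exact deg_eq (by push_cast; ring) (mul_mem_deg ih (X_mem_deg i))

theorem cosetWord_mem_deg (k j : ℕ) : cosetWord n k j ∈ deg n (-(2 * j)) := by
  induction j with
  | zero => exact one_mem_deg
  | succ j ih => exact deg_eq (by push_cast; ring) (mul_mem_deg (D_mem_deg _) ih)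

theorem leadCoord_mem_deg (k a : ℕ) : leadCoord n k a ∈ deg n (-(2 * a)) :=
  AddSubgroup.zsmul_mem _ (cosetWord_mem_deg k a) _

theorem coord_mem_deg (k a b : ℕ) : coord n k a b ∈ deg n (-(2 * b)) := by
  induction a with
  | zero => exact zero_mem _
  | succ a ih =>
    unfold coord
    split_ifs with h
    · rw [h]; exact leadCoord_mem_deg k a
    · refine deg_eq (add_zero _) (mul_mem_deg ih (sub_mem one_mem_deg ?_))
      exact deg_eq (add_neg_cancel _) (mul_mem_deg (X_pow_mem_deg k a) (leadCoord_mem_deg k a))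

end SpinNilHeckeB

namespace SkewPol

variable {n : ℕ}

/-! ### The odd Demazure operators satisfy the nilHecke relations -/

/-- Induction principle for skew polynomials: an additive property that holds for `1` and is
preserved by left multiplication by the variables holds throughout. -/
theorem mem_of_one_mem_of_x_mul_mem (S : AddSubgroup (SkewPol n)) (h1 : 1 ∈ S)
    (hx : ∀ l, ∀ f ∈ S, x l * f ∈ S) (f : SkewPol n) : f ∈ S := by
  suffices h : ∀ (p : FreeAlgebra ℤ (Fin n)), ∀ g ∈ S, mk n p * g ∈ S by
    obtain ⟨p, rfl⟩ : ∃ p, mk n p = f := RingQuot.mkRingHom_surjective (SkewPolRel n) f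
    simpa using h p 1 h1
  intro p
  induction p using FreeAlgebra.induction with
  | grade0 r =>
    intro g hg
    rw [eq_intCast, map_intCast, ← zsmul_eq_mul]
    exact zsmul_mem hg r
  | grade1 j => exact hx j
  | mul a b ha hb =>
    intro g hg
    rw [map_mul, mul_assoc]
    exact ha _ (hb g hg)
  | add a b ha hb =>
    intro g hg
    rw [map_add, add_mul]
    exact add_mem (ha g hg) (hb g hg)

/-- Operator identities on skew polynomials may be checked on `1` and, inductively, on products with
a variable; this reduces the relations among the `∂_i` to their commutation with the `x_j`. -/
theorem linearMap_ext_of_x_mul {T U : SkewPol n →ₗ[ℤ] SkewPol n} (h1 : T 1 = U 1)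
    (hx : ∀ l f, T f = U f → T (x l * f) = U (x l * f)) : T = U := by
  ext f
  exact mem_of_one_mem_of_x_mul_mem (LinearMap.eqLocus T U).toAddSubgroup h1 (fun l f => hx l f) f

theorem demazure_x_mul (i j : Fin n) (f : SkewPol n) :
    demazure i (x j * f) = (demazureVal i j : SkewPol n) * f
      - x (Equiv.swap i (next i) j) * demazure i f := by
  rw [demazure_mul, demazure_x, s_x, demazureVal, neg_mul, ← sub_eq_add_neg]
  split_ifs <;> simp

theorem demazure_x_self_mul {i j : Fin n} (h : next i = j) (f : SkewPol n) :
    demazure i (x i * f) = f - x j * demazure i f := by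
  rw [demazure_x_mul, Equiv.swap_apply_left, h]
  simp [demazureVal]

theorem demazure_x_next_mul {i j : Fin n} (h : next i = j) (f : SkewPol n) :
    demazure i (x j * f) = f - x i * demazure i f := by
  rw [demazure_x_mul, h, Equiv.swap_apply_right]
  simp [demazureVal, h]

theorem demazure_x_mul_of_ne {i j : Fin n} (h : j ≠ i) (h' : j ≠ next i) (f : SkewPol n) :
    demazure i (x j * f) = -(x j * demazure i f) := by
  rw [demazure_x_mul, Equiv.swap_apply_of_ne_of_ne h h']
  simp [demazureVal, h, h']

theorem demazure_demazure (i : Fin n) (f : SkewPol n) : demazure i (demazure i f) = 0 := by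
  refine LinearMap.congr_fun (linearMap_ext_of_x_mul (T := demazure i ∘ₗ demazure i) (U := 0)
    ?_ fun l f h => ?_) f
  · simp [demazure_one]
  · replace h : demazure i (demazure i f) = 0 := h
    change demazure i (demazure i (x l * f)) = 0
    by_cases h1 : l = i
    · subst h1
      rw [demazure_x_self_mul rfl, map_sub, demazure_x_next_mul rfl, h]
      simp
    by_cases h2 : l = next i
    · subst h2
      rw [demazure_x_next_mul rfl, map_sub, demazure_x_self_mul rfl, h]
      simp
    · rw [demazure_x_mul_of_ne h1 h2, map_neg, demazure_x_mul_of_ne h1 h2, h]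
      simp

theorem next_of_lt {i j : Fin n} (h : i.val + 1 = j.val) : next i = j := by
  unfold next
  rw [dif_pos (by omega)]
  exact Fin.ext h

theorem next_of_last {i : Fin n} (h : i.val + 1 = n) : next i = i := dif_neg (by omega)

theorem demazure_braid {i j : Fin n} (h : i.val + 1 = j.val) (hj : j.val + 1 < n)
    (f : SkewPol n) :
    demazure i (demazure j (demazure i f)) = demazure j (demazure i (demazure j f)) := by
  refine LinearMap.congr_fun (linearMap_ext_of_x_mul
    (T := demazure i ∘ₗ demazure j ∘ₗ demazure i) (U := demazure j ∘ₗ demazure i ∘ₗ demazure j)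
    ?_ fun l f ih => ?_) f
  · simp [demazure_one]
  simp only [LinearMap.comp_apply] at ih ⊢
  obtain ⟨k, hk⟩ : ∃ k : Fin n, j.val + 1 = k.val := ⟨⟨j.val + 1, hj⟩, rfl⟩
  have hij := next_of_lt h
  have hjk := next_of_lt hk
  have a1 := demazure_x_self_mul hij
  have a2 := demazure_x_next_mul hij
  have b1 := demazure_x_self_mul hjk
  have b2 := demazure_x_next_mul hjk
  have a3 : ∀ f, demazure i (x k * f) = -(x k * demazure i f) :=
    demazure_x_mul_of_ne (by omega) (by omega)
  have b3 : ∀ f, demazure j (x i * f) = -(x i * demazure j f) :=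
    demazure_x_mul_of_ne (by omega) (by omega)
  by_cases hli : l = i
  · simp only [hli, a1, a3, b1, b3, map_sub, map_neg, demazure_demazure, ih]
    abel
  by_cases hlj : l = j
  · simp only [hlj, a1, a2, a3, b1, b2, b3, map_sub, map_neg, ih]
    abel
  by_cases hlk : l = k
  · simp only [hlk, a2, a3, b2, b3, map_sub, map_neg, demazure_demazure, ih]
    abel
  have a4 := demazure_x_mul_of_ne hli (hij ▸ hlj)
  have b4 := demazure_x_mul_of_ne hlj (hjk ▸ hlk)
  simp only [a4, b4, map_neg, ih]

theorem demazure_braid_last {i j : Fin n} (h : i.val + 1 = j.val) (hj : j.val + 1 = n)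
    (f : SkewPol n) :
    demazure j (demazure i (demazure j (demazure i f))) =
      -demazure i (demazure j (demazure i (demazure j f))) := by
  refine LinearMap.congr_fun (linearMap_ext_of_x_mul
    (T := demazure j ∘ₗ demazure i ∘ₗ demazure j ∘ₗ demazure i)
    (U := -(demazure i ∘ₗ demazure j ∘ₗ demazure i ∘ₗ demazure j))
    ?_ fun l f ih => ?_) f
  · simp [demazure_one]
  simp only [LinearMap.comp_apply, LinearMap.neg_apply] at ih ⊢
  have hij := next_of_lt h
  have hjj := next_of_last hj
  have a1 := demazure_x_self_mul hij
  have a2 := demazure_x_next_mul hij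
  have b2 := demazure_x_self_mul hjj
  have b3 : ∀ f, demazure j (x i * f) = -(x i * demazure j f) :=
    demazure_x_mul_of_ne (by omega) (by omega)
  by_cases hli : l = i
  · simp only [hli, a1, a2, b2, b3, map_sub, map_neg, demazure_demazure, ih, map_zero, mul_neg]
    abel
  by_cases hlj : l = j
  · simp only [hlj, a1, a2, b2, b3, map_sub, map_neg, demazure_demazure, ih, map_zero, mul_neg]
    abel
  have a4 := demazure_x_mul_of_ne hli (hij ▸ hlj)
  have b4 := demazure_x_mul_of_ne hlj (hjj.symm ▸ hlj)
  simp only [a4, b4, map_neg, ih, mul_neg, neg_neg]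

theorem demazure_anti {i j : Fin n} (h : i.val + 1 < j.val) (f : SkewPol n) :
    demazure i (demazure j f) = -demazure j (demazure i f) := by
  refine LinearMap.congr_fun (linearMap_ext_of_x_mul
    (T := demazure i ∘ₗ demazure j) (U := -(demazure j ∘ₗ demazure i)) ?_ fun l f ih => ?_) f
  · simp [demazure_one]
  simp only [LinearMap.comp_apply, LinearMap.neg_apply] at ih ⊢
  obtain ⟨i', hi⟩ : ∃ k : Fin n, i.val + 1 = k.val := ⟨⟨i.val + 1, by omega⟩, rfl⟩
  have hi' := next_of_lt hi
  obtain ⟨j', hj'⟩ : ∃ k, next j = k := ⟨_, rfl⟩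
  have hj : j.val ≤ j'.val := by
    rw [← hj', next]
    split_ifs
    · exact Nat.le_succ _
    · exact le_rfl
  have a1 := demazure_x_self_mul hi'
  have a2 := demazure_x_next_mul hi'
  have b1 := demazure_x_self_mul hj'
  have b2 := demazure_x_next_mul hj'
  have a3 : ∀ f, demazure i (x j * f) = -(x j * demazure i f) :=
    demazure_x_mul_of_ne (by omega) (by omega)
  have a4 : ∀ f, demazure i (x j' * f) = -(x j' * demazure i f) :=
    demazure_x_mul_of_ne (by omega) (by omega)
  have b3 : ∀ f, demazure j (x i * f) = -(x i * demazure j f) :=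
    demazure_x_mul_of_ne (by omega) (by omega)
  have b4 : ∀ f, demazure j (x i' * f) = -(x i' * demazure j f) :=
    demazure_x_mul_of_ne (by omega) (by omega)
  by_cases h1 : l = i
  · simp only [h1, a1, b3, b4, map_sub, map_neg, ih, mul_neg]
  by_cases h2 : l = i'
  · simp only [h2, a2, b3, b4, map_sub, map_neg, ih, mul_neg]
  by_cases h3 : l = j
  · simp only [h3, a3, a4, b1, map_sub, map_neg, ih, mul_neg]
    abel
  by_cases h4 : l = j'
  · simp only [h4, a3, a4, b2, map_sub, map_neg, ih, mul_neg]
    abel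
  have a5 := demazure_x_mul_of_ne h1 (hi' ▸ h2)
  have b5 := demazure_x_mul_of_ne h3 (hj' ▸ h4)
  simp only [a5, b5, map_neg, ih, mul_neg]

/-! ### The action of the nilHecke algebra on skew polynomials -/

theorem op_smul_def (c : (symm n).op) (f : SkewPol n) :
    c • f = f * MulOpposite.unop (c : (SkewPol n)ᵐᵒᵖ) := rfl

theorem demazure_mul_symm (i : Fin n) (f : SkewPol n) {c : SkewPol n} (hc : c ∈ symm n) :
    demazure i (f * c) = demazure i f * c := by
  rw [demazure_mul, hc i, mul_zero, add_zero]

/-- Left multiplication by `x_i`, as an endomorphism of the right module of skew polynomials over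
the symmetric ones. -/
noncomputable def mulX (i : Fin n) : EndSymm n where
  toFun f := x i * f
  map_add' := mul_add _
  map_smul' c f := by simp only [op_smul_def, RingHom.id_apply, mul_assoc]

/-- The odd Demazure operator, as an endomorphism of the right module of skew polynomials over the
symmetric ones. -/
noncomputable def demazureEnd (i : Fin n) : EndSymm n where
  toFun f := demazure i f
  map_add' := map_add _
  map_smul' c f := demazure_mul_symm i f c.2

theorem mulX_apply (i : Fin n) (f : SkewPol n) : mulX i f = x i * f := rfl

theorem demazureEnd_apply (i : Fin n) (f : SkewPol n) : demazureEnd i f = demazure i f := rfl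

/-- The operators by which the generators of the nilHecke algebra act. -/
noncomputable def genEnd : NilHeckeGen n → EndSymm n
  | .x i => mulX i
  | .d i => demazureEnd i

end SkewPol

namespace SpinNilHeckeB

open SkewPol

variable {n : ℕ}

/-- The homomorphism from the nilHecke algebra to the endomorphism ring of the skew polynomials
over the symmetric ones. -/
noncomputable def action (n : ℕ) : SpinNilHeckeB n →+* EndSymm n :=
  RingQuot.lift ⟨(FreeAlgebra.lift ℤ genEnd : FreeAlgebra ℤ (NilHeckeGen n) →ₐ[ℤ] _).toRingHom, by
    intro a b h
    refine LinearMap.ext fun f => ?_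
    induction h with
    | x_anti i j h =>
      simpa [genEnd, mulX_apply, add_mul, mul_assoc] using congrArg (· * f) (x_anti i j h)
    | d_sq i => simpa [genEnd, demazureEnd_apply] using demazure_demazure i f
    | braid i j h hj => simpa [genEnd, demazureEnd_apply] using demazure_braid h hj f
    | braid_last i j h hj => simpa [genEnd, demazureEnd_apply] using demazure_braid_last h hj f
    | d_anti i j h => simp [genEnd, demazureEnd_apply, demazure_anti h f]
    | x_d i j h =>
      simp [genEnd, demazureEnd_apply, mulX_apply, demazure_x_next_mul (next_of_lt h)]
    | d_x i j h =>
      simp [genEnd, demazureEnd_apply, mulX_apply, demazure_x_self_mul (next_of_lt h)]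
    | d_x_last i h =>
      simp [genEnd, demazureEnd_apply, mulX_apply, demazure_x_self_mul (next_of_last h)]
    | d_x_anti i j h h' =>
      have hne : j ≠ next i := by
        unfold next
        split_ifs
        · exact fun e => h' (congrArg Fin.val e)
        · exact fun e => h (congrArg Fin.val e)
      simp [genEnd, demazureEnd_apply, mulX_apply,
        demazure_x_mul_of_ne (fun e => h (congrArg Fin.val e)) hne]⟩

theorem action_gen (g : NilHeckeGen n) : action n (gen g) = genEnd g := by
  unfold action gen
  refine (RingQuot.lift_mkRingHom_apply _ _ _).trans ?_
  simp

noncomputable instance : Module (SpinNilHeckeB n) (SkewPol n) :=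
  Module.compHom (SkewPol n) (action n)

theorem smul_eq_action (a : SpinNilHeckeB n) (f : SkewPol n) : a • f = action n a f := rfl

theorem gen_x_smul (i : Fin n) (f : SkewPol n) : gen (.x i) • f = x i * f := by
  rw [smul_eq_action, action_gen]; rfl

theorem gen_d_smul (i : Fin n) (f : SkewPol n) : gen (.d i) • f = demazure i f := by
  rw [smul_eq_action, action_gen]; rfl

theorem smul_mul_symm (a : SpinNilHeckeB n) (f : SkewPol n) {c : SkewPol n} (hc : c ∈ symm n) :
    a • (f * c) = a • f * c :=
  map_smul (action n a) (⟨MulOpposite.op c, hc⟩ : (symm n).op) f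

theorem mem_invariants_zero_iff {f : SkewPol n} :
    f ∈ invariants n (SkewPol n) 0 ↔ f ∈ symm n := by
  constructor
  · intro h i
    rw [← gen_d_smul, ← D_val]
    exact h i (Nat.zero_le _)
  · intro h i _
    by_cases hi : i < n
    · rw [D, dif_pos hi, gen_d_smul]
      exact h _
    · rw [D_of_le (by omega), zero_smul]

/-- The natural homomorphism from the skew polynomials to the nilHecke algebra. -/
noncomputable def ofPol (n : ℕ) : SkewPol n →+* SpinNilHeckeB n :=
  SkewPol.lift (fun i => gen (.x i)) gen_x_anti

theorem ofPol_x (i : Fin n) : ofPol n (SkewPol.x i) = gen (.x i) := lift_x _ _ _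

theorem gen_d_mul_gen_x (i j : Fin n) : gen (.d i) * gen (.x j) =
    (demazureVal i j : SpinNilHeckeB n) - gen (.x (Equiv.swap i (next i) j)) * gen (.d i) := by
  rw [← X_val, ← X_val, ← D_val]
  by_cases h : i.val + 1 < n
  · have hn : next i = ⟨i.val + 1, h⟩ := next_of_lt rfl
    by_cases h1 : j = i
    · rw [h1, Equiv.swap_apply_left, D_mul_X_self h]
      simp [demazureVal, hn]
    by_cases h2 : j = next i
    · rw [h2, Equiv.swap_apply_right, hn]
      simp [demazureVal, hn, D_mul_X_succ h]
    · rw [Equiv.swap_apply_of_ne_of_ne h1 h2, demazureVal, if_neg (by tauto),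
        D_mul_X_of_ne (by omega) (fun e => h2 (by rw [hn]; exact Fin.ext e))]
      simp
  · have hn : next i = i := next_of_last (by omega)
    rw [hn, Equiv.swap_self, Equiv.refl_apply]
    by_cases h1 : j = i
    · rw [h1, D_mul_X_last (by omega)]
      simp [demazureVal]
    · rw [demazureVal, hn, if_neg (by tauto), D_mul_X_of_ne (by omega) (by omega)]
      simp

/-- The Leibniz rule inside the nilHecke algebra. -/
theorem gen_d_mul_ofPol (i : Fin n) (f : SkewPol n) :
    gen (.d i) * ofPol n f = ofPol n (demazure i f) + ofPol n (s i f) * gen (.d i) := by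
  let T : SkewPol n →+ SpinNilHeckeB n :=
    (AddMonoidHom.mulLeft (gen (.d i))).comp (ofPol n).toAddMonoidHom
  let U : SkewPol n →+ SpinNilHeckeB n :=
    (ofPol n).toAddMonoidHom.comp (demazure i).toAddMonoidHom +
      ((AddMonoidHom.mulRight (gen (.d i))).comp (ofPol n).toAddMonoidHom).comp
        (s i).toAddMonoidHom
  refine mem_of_one_mem_of_x_mul_mem (T.eqLocus U) ?_ (fun l f h => ?_) f
  · change gen (.d i) * ofPol n 1 = ofPol n (demazure i 1) + ofPol n (s i 1) * gen (.d i)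
    simp [demazure_one]
  · replace h : gen (.d i) * ofPol n f =
      ofPol n (demazure i f) + ofPol n (s i f) * gen (.d i) := h
    change gen (.d i) * ofPol n (x l * f) =
      ofPol n (demazure i (x l * f)) + ofPol n (s i (x l * f)) * gen (.d i)
    rw [demazure_x_mul, map_mul (s i), s_x, map_sub, map_mul, map_mul, map_mul, map_mul, map_neg,
      ofPol_x, ofPol_x, map_intCast, ← mul_assoc, gen_d_mul_gen_x, sub_mul, mul_assoc _ (gen _),
      h, mul_add, neg_mul, neg_mul, mul_assoc]
    abel

/-- On an invariant element of any module over the nilHecke algebra, a product of an element of the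
algebra and a skew polynomial acts as a skew polynomial. -/
theorem smul_ofPol_smul {M : Type*} [AddCommGroup M] [Module (SpinNilHeckeB n) M]
    (a : SpinNilHeckeB n) (f : SkewPol n) {c : M} (hc : c ∈ invariants n M 0) :
    a • ofPol n f • c = ofPol n (a • f) • c := by
  obtain ⟨p, rfl⟩ : ∃ p, mk n p = a := RingQuot.mkRingHom_surjective (NilHeckeRel n) a
  induction p using FreeAlgebra.induction generalizing f with
  | grade0 r =>
    rw [eq_intCast, map_intCast, Int.cast_smul_eq_zsmul, Int.cast_smul_eq_zsmul, map_zsmul,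
      smul_assoc]
  | grade1 g =>
    change gen g • ofPol n f • c = ofPol n (gen g • f) • c
    cases g with
    | x i => rw [gen_x_smul, map_mul, ofPol_x, mul_smul]
    | d i =>
      rw [gen_d_smul, ← mul_smul, gen_d_mul_ofPol, add_smul, mul_smul, ← D_val,
        hc i (Nat.zero_le _), smul_zero, add_zero]
  | mul a b ha hb => rw [map_mul, mul_smul, hb, ha, mul_smul]
  | add a b ha hb => rw [map_add, add_smul, ha, hb, add_smul, map_add, add_smul]

theorem ofPol_smul (f g : SkewPol n) : ofPol n f • g = f * g := by
  let T : SkewPol n →+ SkewPol n :=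
    ((smulAddHom (SpinNilHeckeB n) (SkewPol n)).flip g).comp (ofPol n).toAddMonoidHom
  refine mem_of_one_mem_of_x_mul_mem (T.eqLocus (AddMonoidHom.mulRight g)) ?_ (fun l f h => ?_) f
  · change ofPol n 1 • g = 1 * g
    rw [map_one, one_smul, one_mul]
  · replace h : ofPol n f • g = f * g := h
    change ofPol n (x l * f) • g = x l * f * g
    rw [map_mul, mul_smul, h, ofPol_x, gen_x_smul, mul_assoc]

end SpinNilHeckeB

namespace SkewPol

variable {n : ℕ}

/-! ### Homogeneity of the action -/

theorem deg_eq {k l : ℤ} (h : k = l) {f : SkewPol n} (hf : f ∈ deg n k) : f ∈ deg n l := h ▸ hf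

theorem one_mem_deg : (1 : SkewPol n) ∈ deg n 0 :=
  AddSubgroup.subset_closure ⟨[], by simp, by simp⟩

theorem x_mem_deg (i : Fin n) : x i ∈ deg n 2 :=
  AddSubgroup.subset_closure ⟨[i], by simp, by simp⟩

theorem mul_mem_deg {k l : ℤ} {f g : SkewPol n} (hf : f ∈ deg n k) (hg : g ∈ deg n l) :
    f * g ∈ deg n (k + l) := by
  induction hf using AddSubgroup.closure_induction with
  | mem f hf =>
    obtain ⟨v, rfl, rfl⟩ := hf
    induction hg using AddSubgroup.closure_induction with
    | mem g hg =>
      obtain ⟨w, rfl, rfl⟩ := hg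
      exact AddSubgroup.subset_closure ⟨v ++ w, by push_cast [List.length_append]; ring, by simp⟩
    | zero => rw [mul_zero]; exact zero_mem _
    | add g g' _ _ h h' => rw [mul_add]; exact add_mem h h'
    | neg g _ h => rw [mul_neg]; exact neg_mem h
  | zero => rw [zero_mul]; exact zero_mem _
  | add f f' _ _ h h' => rw [add_mul]; exact add_mem h h'
  | neg f _ h => rw [neg_mul]; exact neg_mem h

theorem x_pow_mem_deg (i : Fin n) (a : ℕ) : x i ^ a ∈ deg n (2 * a) := by
  induction a with
  | zero => simpa using one_mem_deg
  | succ a ih => rw [pow_succ]; exact deg_eq (by push_cast; ring) (mul_mem_deg ih (x_mem_deg i))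

theorem demazure_mem_deg (i : Fin n) {k : ℤ} {f : SkewPol n} (hf : f ∈ deg n k) :
    demazure i f ∈ deg n (k - 2) := by
  induction hf using AddSubgroup.closure_induction with
  | mem f hf =>
    obtain ⟨w, rfl, rfl⟩ := hf
    induction w with
    | nil => rw [List.map_nil, List.prod_nil, demazure_one]; exact zero_mem _
    | cons j w ih =>
      rw [List.map_cons, List.prod_cons, demazure_x_mul, ← zsmul_eq_mul]
      have hw : (w.map x).prod ∈ deg n (2 * ((j :: w).length : ℤ) - 2) :=
        AddSubgroup.subset_closure ⟨w, by push_cast [List.length_cons]; ring, rfl⟩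
      exact sub_mem (zsmul_mem hw _)
        (deg_eq (by push_cast [List.length_cons]; ring) (mul_mem_deg (x_mem_deg _) ih))
  | zero => rw [map_zero]; exact zero_mem _
  | add f f' _ _ h h' => rw [map_add]; exact add_mem h h'
  | neg f _ h => rw [map_neg]; exact neg_mem h

end SkewPol

namespace SpinNilHeckeB

variable {n : ℕ}

theorem smul_mem_deg {k m : ℤ} {a : SpinNilHeckeB n} (ha : a ∈ deg n k) {f : SkewPol n}
    (hf : f ∈ SkewPol.deg n m) : a • f ∈ SkewPol.deg n (m + k) := by
  induction ha using AddSubgroup.closure_induction with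
  | mem a ha =>
    obtain ⟨w, rfl, rfl⟩ := ha
    induction w with
    | nil => simpa using hf
    | cons g w ih =>
      have hprod : ((g :: w).map gen).prod = gen g * (w.map gen).prod := List.prod_cons
      rw [hprod, mul_smul, List.map_cons, List.sum_cons]
      cases g with
      | x i =>
        rw [gen_x_smul]
        refine SkewPol.deg_eq ?_ (SkewPol.mul_mem_deg (SkewPol.x_mem_deg i) ih)
        rw [NilHeckeGen.weight]
        ring
      | d i =>
        rw [gen_d_smul]
        refine SkewPol.deg_eq ?_ (SkewPol.demazure_mem_deg i ih)
        rw [NilHeckeGen.weight]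
        ring
  | zero => rw [zero_smul]; exact zero_mem _
  | add a a' _ _ h h' => rw [add_smul]; exact add_mem h h'
  | neg a _ h => rw [neg_smul]; exact neg_mem h

theorem ofPol_mem_deg {k : ℤ} {f : SkewPol n} (hf : f ∈ SkewPol.deg n k) :
    ofPol n f ∈ deg n k := by
  induction hf using AddSubgroup.closure_induction with
  | mem f hf =>
    obtain ⟨w, rfl, rfl⟩ := hf
    refine AddSubgroup.subset_closure ⟨w.map .x, ?_, ?_⟩
    · have : (NilHeckeGen.weight ∘ NilHeckeGen.x : Fin n → ℤ) = fun _ => 2 := rfl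
      simp [this, mul_comm]
    · rw [map_list_prod, List.map_map, List.map_map]
      exact congrArg (fun v : Fin n → SpinNilHeckeB n => (w.map v).prod) (funext ofPol_x)
  | zero => rw [map_zero]; exact zero_mem _
  | add f f' _ _ h h' => rw [map_add]; exact add_mem h h'
  | neg f _ h => rw [map_neg]; exact neg_mem h

/-! ### Dual systems -/

/-- A finite homogeneous family of skew polynomials together with coordinate operators from the
nilHecke algebra: in every module over the nilHecke algebra each element is a unique combination of
the polynomials `basis i` applied to elements of `invariants n M k`, and `coord i` computes the
`i`-th of these elements. -/
structure DualSystem (n k : ℕ) (ι : Type) [Fintype ι] [DecidableEq ι] where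
  /-- The homogeneous basis. -/
  basis : ι → SkewPol n
  /-- The coordinate operators. -/
  coord : ι → SpinNilHeckeB n
  /-- The degrees of the basis elements. -/
  degree : ι → ℕ
  basis_mem_deg (i : ι) : basis i ∈ SkewPol.deg n (degree i)
  coord_mem_deg (i : ι) : coord i ∈ deg n (-(degree i))
  coord_smul_mem {M : Type} [AddCommGroup M] [Module (SpinNilHeckeB n) M] (i : ι) (f : M) :
    coord i • f ∈ invariants n M k
  sum_basis_smul_coord_smul {M : Type} [AddCommGroup M] [Module (SpinNilHeckeB n) M] (f : M) :
    ∑ i, ofPol n (basis i) • coord i • f = f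
  coord_smul_basis_smul {M : Type} [AddCommGroup M] [Module (SpinNilHeckeB n) M] (i j : ι) (c : M)
    (hc : c ∈ invariants n M k) : coord i • ofPol n (basis j) • c = if i = j then c else 0

namespace DualSystem

variable {k : ℕ} {ι κ : Type} [Fintype ι] [DecidableEq ι] [Fintype κ] [DecidableEq κ]

/-- The top of the tower, where `invariants n M n` is all of `M`: the basis is `1`. -/
noncomputable def trivial (n : ℕ) : DualSystem n n Unit where
  basis _ := 1
  coord _ := 1
  degree _ := 0
  basis_mem_deg _ := SkewPol.one_mem_deg
  coord_mem_deg _ := one_mem_deg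
  coord_smul_mem _ f i hi := by rw [D_of_le hi, zero_smul]
  sum_basis_smul_coord_smul f := by simp
  coord_smul_basis_smul i j c hc := by simp

theorem ofPol_x_pow (hk : k < n) (a : ℕ) :
    ofPol n (SkewPol.x ⟨k, hk⟩ ^ a) = X n k ^ a := by
  rw [map_pow, ofPol_x, ← X_val]

/-- Going one step down the tower of partial invariants multiplies the basis by the powers
`1, x_k, …, x_k ^ (2 (n - k) - 1)`. -/
noncomputable def extend (hk : k < n) (S : DualSystem n (k + 1) ι) :
    DualSystem n k (ι × Fin (2 * (n - k))) where
  basis p := S.basis p.1 * SkewPol.x ⟨k, hk⟩ ^ (p.2 : ℕ)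
  coord p := SpinNilHeckeB.coord n k (2 * (n - k)) p.2 * S.coord p.1
  degree p := S.degree p.1 + 2 * p.2
  basis_mem_deg p := SkewPol.deg_eq (by push_cast; ring)
    (SkewPol.mul_mem_deg (S.basis_mem_deg p.1) (SkewPol.x_pow_mem_deg _ _))
  coord_mem_deg p := deg_eq (by push_cast; ring)
    (mul_mem_deg (SpinNilHeckeB.coord_mem_deg k _ _) (S.coord_mem_deg p.1))
  coord_smul_mem p f := by
    rw [mul_smul]
    exact (coord_decomposition hk.le le_rfl (S.coord_smul_mem p.1 f)
      (cosetWord_length_smul hk _)).1 _ p.2.isLt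
  sum_basis_smul_coord_smul f := by
    refine Eq.trans ?_ (S.sum_basis_smul_coord_smul f)
    rw [Fintype.sum_prod_type]
    refine Finset.sum_congr rfl fun i _ => ?_
    simp only [map_mul, ofPol_x_pow, mul_smul, ← Finset.smul_sum]
    rw [Fin.sum_univ_eq_sum_range
      (fun a => X n k ^ a • SpinNilHeckeB.coord n k (2 * (n - k)) a • S.coord i • f),
      (coord_decomposition hk.le le_rfl (S.coord_smul_mem i f) (cosetWord_length_smul hk _)).2]
  coord_smul_basis_smul p q c hc := by
    rw [map_mul, ofPol_x_pow, mul_smul, mul_smul, S.coord_smul_basis_smul _ _ _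
      (X_pow_smul_mem_invariants (invariants_mono (Nat.le_succ k) hc) _)]
    by_cases h : p.1 = q.1
    · rw [if_pos h, coord_smul_X_pow hk.le hc le_rfl p.2.isLt q.2.isLt]
      simp only [Prod.ext_iff, h, true_and, Fin.ext_iff]
    · rw [if_neg h, smul_zero, if_neg fun e => h (congrArg Prod.fst e)]

/-- A dual system with its index type replaced by an equivalent one. -/
noncomputable def reindex (e : κ ≃ ι) (S : DualSystem n k ι) : DualSystem n k κ where
  basis i := S.basis (e i)
  coord i := S.coord (e i)
  degree i := S.degree (e i)
  basis_mem_deg i := S.basis_mem_deg _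
  coord_mem_deg i := S.coord_mem_deg _
  coord_smul_mem i f := S.coord_smul_mem _ f
  sum_basis_smul_coord_smul f :=
    (e.sum_comp fun i => ofPol n (S.basis i) • S.coord i • f).trans (S.sum_basis_smul_coord_smul f)
  coord_smul_basis_smul i j c hc := by
    rw [S.coord_smul_basis_smul _ _ c hc]
    simp

end DualSystem

theorem ratFunc_X_sub_inv_ne_zero : (RatFunc.X - RatFunc.X⁻¹ : RatFunc ℚ) ≠ 0 := by
  intro h
  have h2 : (RatFunc.X : RatFunc ℚ) ^ 2 = 1 := by
    have hX := RatFunc.X_ne_zero (K := ℚ)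
    field_simp at h
    linear_combination h
  have h3 : (Polynomial.X : Polynomial ℚ) ^ 2 = 1 := by
    apply RatFunc.algebraMap_injective ℚ
    simpa [RatFunc.algebraMap_X] using h2
  have h4 := congrArg (Polynomial.eval 2) h3
  norm_num at h4

theorem sum_X_pow_eq_qInt (t : ℕ) :
    ∑ a ∈ Finset.range (2 * (t + 1)), (RatFunc.X : RatFunc ℚ) ^ (2 * a) =
      RatFunc.X ^ (2 * t + 1) * qInt (2 * (t + 1)) := by
  have h := ratFunc_X_sub_inv_ne_zero
  have hX := RatFunc.X_ne_zero (K := ℚ)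
  rw [qInt, ← mul_div_assoc, eq_div_iff h]
  have := geom_sum_mul ((RatFunc.X : RatFunc ℚ) ^ 2) (2 * (t + 1))
  simp only [← pow_mul] at this
  have e : (RatFunc.X - RatFunc.X⁻¹ : RatFunc ℚ) = (RatFunc.X ^ 2 - 1) * RatFunc.X⁻¹ := by
    field_simp
  rw [e, ← mul_assoc, this, inv_pow]
  field_simp
  ring

/-- The tower of partial invariants yields a dual system over the invariants whose degree generating
function is the graded size `q^{n²} [2n]!!`. -/
theorem exists_dualSystem {k t : ℕ} (h : k + t = n) :
    ∃ (ι : Type) (_ : Fintype ι) (_ : DecidableEq ι) (S : DualSystem n k ι),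
      Fintype.card ι = 2 ^ t * t ! ∧
        ∑ i, (RatFunc.X : RatFunc ℚ) ^ S.degree i = RatFunc.X ^ (t ^ 2) * qDoubleFactorial t := by
  induction t generalizing k with
  | zero =>
    obtain rfl : k = n := h
    exact ⟨Unit, inferInstance, inferInstance, DualSystem.trivial k, by simp,
      by simp [DualSystem.trivial, qDoubleFactorial]⟩
  | succ t ih =>
    obtain ⟨ι, _, _, S, hc, hd⟩ := ih (k := k + 1) (by omega)
    have e : 2 * (n - k) = 2 * (t + 1) := by omega
    refine ⟨_, _, inferInstance, S.extend (by omega), ?_, ?_⟩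
    · rw [Fintype.card_prod, hc, Fintype.card_fin, e, Nat.factorial_succ]
      ring
    · have hq : qDoubleFactorial (t + 1) = qDoubleFactorial t * qInt (2 * (t + 1)) :=
        Finset.prod_Icc_succ_top (by omega) _
      simp only [DualSystem.extend, pow_add, Fintype.sum_prod_type, ← Finset.mul_sum,
        ← Finset.sum_mul, hd]
      rw [Fin.sum_univ_eq_sum_range (fun a => (RatFunc.X : RatFunc ℚ) ^ (2 * a)), e,
        sum_X_pow_eq_qInt, hq]
      ring

end SpinNilHeckeB

namespace SpinNilHeckeB

variable {n : ℕ}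

/-! ### The two isomorphisms -/

theorem map_mul_symm (T : SkewPol.EndSymm n) (f : SkewPol n) (c : SkewPol.symm n) :
    T (f * c) = T f * c :=
  map_smul T (⟨MulOpposite.op (c : SkewPol n), c.2⟩ : (SkewPol.symm n).op) f

namespace DualSystem

variable {ι : Type} [Fintype ι] [DecidableEq ι] (S : DualSystem n 0 ι)

/-- The coordinates of a skew polynomial with respect to a dual system, as symmetric polynomials. -/
noncomputable def symmCoord (i : ι) (f : SkewPol n) : SkewPol.symm n :=
  ⟨S.coord i • f, mem_invariants_zero_iff.mp (S.coord_smul_mem i f)⟩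

theorem coe_symmCoord (i : ι) (f : SkewPol n) : (S.symmCoord i f : SkewPol n) = S.coord i • f := rfl

theorem sum_basis_mul_symmCoord (f : SkewPol n) : ∑ i, S.basis i * (S.symmCoord i f) = f := by
  simpa only [ofPol_smul, coe_symmCoord] using S.sum_basis_smul_coord_smul f

theorem symmCoord_add (i : ι) (f g : SkewPol n) :
    S.symmCoord i (f + g) = S.symmCoord i f + S.symmCoord i g := Subtype.ext (smul_add _ _ _)

theorem symmCoord_sum {κ : Type} (s : Finset κ) (i : ι) (f : κ → SkewPol n) :
    S.symmCoord i (∑ j ∈ s, f j) = ∑ j ∈ s, S.symmCoord i (f j) :=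
  map_sum (AddMonoidHom.mk' (S.symmCoord i) (S.symmCoord_add i)) f s

theorem symmCoord_mul (i : ι) (f : SkewPol n) (c : SkewPol.symm n) :
    S.symmCoord i (f * c) = S.symmCoord i f * c := Subtype.ext (smul_mul_symm _ f c.2)

theorem symmCoord_basis (i j : ι) : S.symmCoord i (S.basis j) = if i = j then 1 else 0 := by
  have h := S.coord_smul_basis_smul i j (1 : SkewPol n)
    (mem_invariants_zero_iff.mpr (one_mem _))
  rw [ofPol_smul, mul_one] at h
  apply Subtype.ext
  rw [coe_symmCoord, h]
  split_ifs <;> rfl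

/-- The element of the nilHecke algebra that acts by a given endomorphism; it is assembled from the
values of the endomorphism on the basis. -/
noncomputable def preimage (T : SkewPol.EndSymm n) : SpinNilHeckeB n :=
  ∑ i, ofPol n (T (S.basis i)) * S.coord i

theorem preimage_smul (T : SkewPol.EndSymm n) (f : SkewPol n) : S.preimage T • f = T f := by
  conv_rhs => rw [← S.sum_basis_mul_symmCoord f]
  rw [preimage, Finset.sum_smul, map_sum]
  refine Finset.sum_congr rfl fun i _ => ?_
  rw [map_mul_symm, coe_symmCoord, mul_smul, ofPol_smul]

/-- Injectivity of the action.  It comes from decomposing the element `1` of the regular module: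
what an element of the algebra does to the invariant element `coord i` is dictated by its action on
the skew polynomial `basis i`. -/
theorem preimage_action (a : SpinNilHeckeB n) : S.preimage (action n a) = a := by
  conv_rhs => rw [← mul_one a, ← S.sum_basis_smul_coord_smul (1 : SpinNilHeckeB n)]
  rw [preimage, Finset.mul_sum]
  refine Finset.sum_congr rfl fun i _ => ?_
  have h := smul_ofPol_smul a (S.basis i) (S.coord_smul_mem i (1 : SpinNilHeckeB n))
  simpa only [smul_eq_mul, mul_one, smul_eq_action] using h.symm

/-- The nilHecke algebra is the endomorphism ring of the skew polynomials over the symmetric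
ones. -/
noncomputable def actionEquiv : SpinNilHeckeB n ≃+* SkewPol.EndSymm n where
  __ := action n
  invFun := S.preimage
  left_inv := S.preimage_action
  right_inv T := LinearMap.ext fun f => S.preimage_smul T f

/-- For the nontrivial direction, `a = ∑ ofPol (a • basis i) * coord i` is a sum of products of
homogeneous factors. -/
theorem mem_deg_iff (k : ℤ) (a : SpinNilHeckeB n) :
    a ∈ deg n k ↔ SkewPol.EndHomogeneous k (S.actionEquiv a) := by
  refine ⟨fun ha m f hf => smul_mem_deg ha hf, fun h => ?_⟩
  rw [← S.preimage_action a]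
  exact sum_mem fun i _ => deg_eq (by ring)
    (mul_mem_deg (ofPol_mem_deg (h _ _ (S.basis_mem_deg i))) (S.coord_mem_deg i))

/-- The endomorphism with a given matrix. -/
noncomputable def ofMatrix (m : Matrix ι ι (SkewPol.symm n)) : SkewPol.EndSymm n where
  toFun f := ∑ j, (∑ i, S.basis i * m i j) * S.symmCoord j f
  map_add' f g := by
    simp only [symmCoord_add, Subring.coe_add, mul_add, Finset.sum_add_distrib]
  map_smul' c f := by
    have h (j : ι) := S.symmCoord_mul j f ⟨_, c.2⟩
    simp only [SkewPol.op_smul_def, RingHom.id_apply, Finset.sum_mul, mul_assoc] at h ⊢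
    simp only [h, Subring.coe_mul]

theorem ofMatrix_basis (m : Matrix ι ι (SkewPol.symm n)) (j : ι) :
    S.ofMatrix m (S.basis j) = ∑ i, S.basis i * m i j := by
  change ∑ l, (∑ i, S.basis i * m i l) * S.symmCoord l (S.basis j) = _
  rw [Finset.sum_eq_single j (fun l _ h => by rw [symmCoord_basis, if_neg h]; simp) (by simp),
    symmCoord_basis, if_pos rfl]
  simp

/-- The isomorphism of the endomorphism ring with a matrix ring over the symmetric polynomials; the
matrix of `T` has as its `j`-th column the coordinates of `T (basis j)`. -/
noncomputable def matrixEquiv : SkewPol.EndSymm n ≃+* Matrix ι ι (SkewPol.symm n) where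
  toFun T := Matrix.of fun i j => S.symmCoord i (T (S.basis j))
  invFun := S.ofMatrix
  left_inv T := LinearMap.ext fun f => by
    change ∑ j, (∑ i, S.basis i * S.symmCoord i (T (S.basis j))) * S.symmCoord j f = T f
    simp only [sum_basis_mul_symmCoord, ← map_mul_symm, ← map_sum]
  right_inv m := by
    refine Matrix.ext fun i j => ?_
    change S.symmCoord i (S.ofMatrix m (S.basis j)) = m i j
    rw [ofMatrix_basis, symmCoord_sum]
    simp only [symmCoord_mul, symmCoord_basis, ite_mul, one_mul, zero_mul, Finset.sum_ite_eq,
      Finset.mem_univ, if_true]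
  map_add' T U := by
    ext i j
    exact congrArg Subtype.val (S.symmCoord_add i _ _)
  map_mul' T U := by
    ext i j
    rw [Matrix.of_apply, Module.End.mul_apply, ← S.sum_basis_mul_symmCoord (U (S.basis j)),
      map_sum, symmCoord_sum, Matrix.mul_apply]
    simp only [map_mul_symm, symmCoord_mul, Matrix.of_apply]

theorem matrixEquiv_apply (T : SkewPol.EndSymm n) (i j : ι) :
    (S.matrixEquiv T i j : SkewPol n) = S.coord i • T (S.basis j) := rfl

theorem endHomogeneous_iff (k : ℤ) (T : SkewPol.EndSymm n) :
    SkewPol.EndHomogeneous k T ↔ ∀ i j,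
      (S.matrixEquiv T i j : SkewPol n) ∈ SkewPol.deg n (k + S.degree j - S.degree i) := by
  constructor
  · intro h i j
    rw [matrixEquiv_apply]
    exact SkewPol.deg_eq (by ring)
      (smul_mem_deg (S.coord_mem_deg i) (h _ _ (S.basis_mem_deg j)))
  · intro h m f hf
    rw [← S.matrixEquiv.symm_apply_apply T]
    change ∑ j, (∑ i, S.basis i * S.matrixEquiv T i j) * S.symmCoord j f ∈ _
    refine sum_mem fun j _ => SkewPol.deg_eq (by ring : k + S.degree j + (m + -S.degree j) = _)
      (SkewPol.mul_mem_deg (sum_mem fun i _ => ?_) (smul_mem_deg (S.coord_mem_deg j) hf))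
    exact SkewPol.deg_eq (by ring) (SkewPol.mul_mem_deg (S.basis_mem_deg i) (h i j))

end DualSystem

end SpinNilHeckeB

/-! ### The order of the Weyl group -/

theorem natCard_weylB (n : ℕ) : Nat.card (weylB n) = 2 ^ n * n ! := by
  set σ : Equiv.Perm (Fin n × ℤˣ) :=
    Equiv.prodCongr (Equiv.refl (Fin n)) (Equiv.neg ℤˣ) with hσ
  have hfix : ∀ p, σ p ≠ p := by
    rintro ⟨i, u⟩ h
    have : -u = u := congrArg Prod.snd h
    rcases Int.units_eq_one_or u with rfl | rfl <;> simp at this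
  have hsq : σ ^ 2 = 1 := by
    ext p <;> simp [hσ, sq]
  -- The sign change is a product of `n` disjoint transpositions.
  have hct : σ.cycleType = Multiset.replicate n 2 := by
    have hmem : ∀ m ∈ σ.cycleType, m = 2 := fun m hm =>
      ((Nat.prime_two.eq_one_or_self_of_dvd m
        ((Equiv.Perm.dvd_of_mem_cycleType hm).trans (orderOf_dvd_of_pow_eq_one hsq))).resolve_left
          (Equiv.Perm.one_lt_of_mem_cycleType hm).ne')
    have hrep := Multiset.eq_replicate_of_mem hmem
    have hsum : σ.cycleType.sum = n * 2 := by
      rw [Equiv.Perm.sum_cycleType, Finset.eq_univ_iff_forall.mpr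
        fun p => Equiv.Perm.mem_support.mpr (hfix p)]
      simp
    rw [hrep, Multiset.sum_replicate, smul_eq_mul] at hsum
    rw [hrep, Nat.eq_of_mul_eq_mul_right two_pos hsum]
  rw [weylB, ← hσ, Equiv.Perm.nat_card_centralizer, hct]
  rcases Nat.eq_zero_or_pos n with rfl | hn
  · simp
  · simp [Multiset.toFinset_replicate, hn.ne']

theorem mainTheorem1 (n : ℕ) (hn : 1 ≤ n) :
    ∃ (Φ : SpinNilHeckeB n ≃+* SkewPol.EndSymm n) (d : Fin (2 ^ n * n !) → ℕ)
      (Ψ : SkewPol.EndSymm n ≃+*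
        Matrix (Fin (2 ^ n * n !)) (Fin (2 ^ n * n !)) (SkewPol.symm n)),
      (∀ (i : Fin n) (f : SkewPol n),
        Φ (SpinNilHeckeB.gen (NilHeckeGen.x i)) f = SkewPol.x i * f) ∧
      (∀ (i : Fin n) (f : SkewPol n),
        Φ (SpinNilHeckeB.gen (NilHeckeGen.d i)) f = SkewPol.demazure i f) ∧
      (∀ (k : ℤ) (a : SpinNilHeckeB n),
        a ∈ SpinNilHeckeB.deg n k ↔ SkewPol.EndHomogeneous k (Φ a)) ∧
      (∀ (k : ℤ) (T : SkewPol.EndSymm n),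
        SkewPol.EndHomogeneous k T ↔
          ∀ i j, (Ψ T i j : SkewPol n) ∈ SkewPol.deg n (k + d j - d i)) ∧
      ∑ i, (RatFunc.X : RatFunc ℚ) ^ d i = RatFunc.X ^ (n ^ 2) * qDoubleFactorial n ∧
      Nat.card (weylB n) = 2 ^ n * n ! := by
  obtain ⟨ι, _, _, S, hc, hd⟩ := SpinNilHeckeB.exists_dualSystem (zero_add n)
  let e : Fin (2 ^ n * n !) ≃ ι := (Fintype.equivFinOfCardEq hc).symm
  let S' := S.reindex e
  exact ⟨S'.actionEquiv, S'.degree, S'.matrixEquiv, fun i f => SpinNilHeckeB.gen_x_smul i f,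
    fun i f => SpinNilHeckeB.gen_d_smul i f, S'.mem_deg_iff, S'.endHomogeneous_iff,
    (e.sum_comp fun i => (RatFunc.X : RatFunc ℚ) ^ S.degree i).trans hd, natCard_weylB n⟩
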